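/- Let $f:\mathbb R^n\to\mathbb R^n$ be locally Lipschitz, $h:\mathbb R^n\to\mathbb R$ continuous and $\mathcal X_0\subset\mathbb R^n$ open. Suppose that for every $x\in\mathcal X_0$ the solution $t\mapsto X(t;x)$ of $\dot X=f(X)$, $X(0;x)=x$, is defined for all $t\in\mathbb R$, and that there is $\gamma_0>0$ such that for every $x\in\mathcal X_0$ there is $C>0$ with $e^{\gamma_0 t}|h(X(t;x))|\le C$ for all $t\le 0$. Put $\mathcal X=\{X(t;x):x\in\mathcal X_0,\ t\ge 0\}$ and fix $\gamma>\gamma_0$. For an interval $J\subset\mathbb R$, a set $S\in\{[0,1),[0,1]\}$ and $u:J\to\mathbb R$, call $w:J\times[0,1]\to\mathbb R$ a classical solution on $J\times S$ with datum $u$ if $w$ is continuous on $J\times[0,1]$, the derivatives $\partial_tw,\partial_\lambda w,\partial_\lambda^2w$ exist (one-sided at end points) and are continuous on $J\times S$, and $$\partial_t w=\partial_\lambda^2w-\gamma w\ \text{ on } J\times S,\qquad \partial_\lambda w(t,0)=0,\qquad w(t,1)=u(t)\qquad (t\in J).$$ Then the following hold. 1. For every $x\in\mathcal X$, with $u_x(t):=-h(X(t;x))$,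 there is exactly one classical solution $w_{u_x}$ on $(-\infty,0]\times[0,1)$ with datum $u_x$ such that, for some $C>0$, $\|w_{u_x}(t,\cdot)\|_{L^2(0,1)}<Ce^{-\gamma t}$ for all $t\le 0$. Hence $T_0(x,\lambda):=w_{u_x}(0,\lambda)$ is well defined for $x\in\mathcal X$, $\lambda\in[0,1]$. 2. For every $x\in\mathcal X_0$, the function $(t,\lambda)\mapsto T_0(X(t;x),\lambda)$ is a classical solution on $[0,\infty)\times[0,1)$ with datum $t\mapsto -h(X(t;x))$, that is, for $t\ge 0$, $$\partial_tT_0(X(t;x),\lambda)=\partial_\lambda^2T_0(X(t;x),\lambda)-\gamma T_0(X(t;x),\lambda)\ (0\le\lambda<1),\quad \partial_\lambda T_0(X(t;x),0)=0,\quad T_0(X(t;x),1)=-h(X(t;x)).$$ 3. If moreover $t\mapsto h(X(t;x))$ is continuously differentiable on $\mathbb R$ (for instance if $h$ is $C^1$), then it is a classical solution on $[0,\infty)\times[0,1]$; in particular the heat equation holds for all $\lambda\in[0,1]$. -/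

import Mathlib

open Set

/-- `c` is a trajectory of `ẋ = f(x)` defined for all times, with value `x` at time `0`. -/
def IsTrajectory {n : ℕ} (f : EuclideanSpace ℝ (Fin n) → EuclideanSpace ℝ (Fin n))
    (x : EuclideanSpace ℝ (Fin n)) (c : ℝ → EuclideanSpace ℝ (Fin n)) : Prop :=
  c 0 = x ∧ ∀ t : ℝ, HasDerivAt c (f (c t)) t

/-- The flow `X(t;x)` of `ẋ = f(x)`. It is meaningful at those `x` whose trajectory is defined for
all times (the trajectory is unique when `f` is locally Lipschitz); elsewhere it is the junk value
`x`. -/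
noncomputable def flow {n : ℕ} (f : EuclideanSpace ℝ (Fin n) → EuclideanSpace ℝ (Fin n))
    (t : ℝ) (x : EuclideanSpace ℝ (Fin n)) : EuclideanSpace ℝ (Fin n) :=
  open Classical in
  if hx : ∃ c : ℝ → EuclideanSpace ℝ (Fin n), IsTrajectory f x c then hx.choose t else x

/-- The set `𝒳 = {X(t;x) : x ∈ 𝒳₀, t ≥ 0}` of trajectories of interest. -/
def trajectorySet {n : ℕ} (f : EuclideanSpace ℝ (Fin n) → EuclideanSpace ℝ (Fin n))
    (X₀ : Set (EuclideanSpace ℝ (Fin n))) : Set (EuclideanSpace ℝ (Fin n)) :=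
  {y | ∃ x ∈ X₀, ∃ t : ℝ, 0 ≤ t ∧ y = flow f t x}

/-- `w` is a classical solution, for times in `J`, of
`∂ₜw = ∂²w/∂l² - γ w`, `∂w/∂l (t,0) = 0`, `w(t,1) = u(t)`.
The function `w` is continuous on `J × [0,1]`; on `J × S` the derivatives `∂ₜw`, `∂w/∂l`,
`∂²w/∂l²` exist (one-sided at the end points), are continuous, and satisfy the equation.
This is used with `S = [0,1)` and with `S = [0,1]`. -/
structure IsHeatSolution (γ : ℝ) (J S : Set ℝ) (u : ℝ → ℝ) (w : ℝ → ℝ → ℝ) : Prop where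
  continuousOn : ContinuousOn (fun p : ℝ × ℝ => w p.1 p.2) (J ×ˢ Icc (0 : ℝ) 1)
  heat_neumann : ∃ wt wl wll : ℝ → ℝ → ℝ,
    ContinuousOn (fun p : ℝ × ℝ => wt p.1 p.2) (J ×ˢ S) ∧
    ContinuousOn (fun p : ℝ × ℝ => wl p.1 p.2) (J ×ˢ S) ∧
    ContinuousOn (fun p : ℝ × ℝ => wll p.1 p.2) (J ×ˢ S) ∧
    (∀ t ∈ J, ∀ l ∈ S,
      HasDerivWithinAt (fun s => w s l) (wt t l) J t ∧
      HasDerivWithinAt (fun r => w t r) (wl t l) S l ∧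
      HasDerivWithinAt (fun r => wl t r) (wll t l) S l ∧
      wt t l = wll t l - γ * w t l) ∧
    (∀ t ∈ J, wl t 0 = 0)
  dirichlet : ∀ t ∈ J, w t 1 = u t

/-- `w` is a solution on `(-∞,0]`, without initial condition, of the heat equation with boundary
input `u` that satisfies `‖w(t,·)‖_{L²(0,1)} < C e^{-γ t}` for some constant `C`. -/
structure IsSteadySolution (γ : ℝ) (u : ℝ → ℝ) (w : ℝ → ℝ → ℝ) : Prop where
  isHeatSolution : IsHeatSolution γ (Iic 0) (Ico 0 1) u w
  growth : ∃ C : ℝ, 0 < C ∧ ∀ t : ℝ, t ≤ 0 →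
    Real.sqrt (∫ l in (0 : ℝ)..1, (w t l) ^ 2) < C * Real.exp (-γ * t)

/-- The solution `w_u` on `(-∞,0]` of the heat equation without initial condition
(the junk value `0` when there is none). -/
noncomputable def steadySolution (γ : ℝ) (u : ℝ → ℝ) : ℝ → ℝ → ℝ :=
  open Classical in
  if hu : ∃ w : ℝ → ℝ → ℝ, IsSteadySolution γ u w then hu.choose else fun _ _ => 0

/-- The boundary input `u_x(t) = -h(X(t;x))`. -/
noncomputable def boundaryInput {n : ℕ}
    (f : EuclideanSpace ℝ (Fin n) → EuclideanSpace ℝ (Fin n))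
    (h : EuclideanSpace ℝ (Fin n) → ℝ) (x : EuclideanSpace ℝ (Fin n)) : ℝ → ℝ :=
  fun t => -h (flow f t x)

/-- The KKL mapping `T₀(x,l) = w_{u_x}(0,l)`. -/
noncomputable def kklMap {n : ℕ} (γ : ℝ)
    (f : EuclideanSpace ℝ (Fin n) → EuclideanSpace ℝ (Fin n))
    (h : EuclideanSpace ℝ (Fin n) → ℝ) (x : EuclideanSpace ℝ (Fin n)) (l : ℝ) : ℝ :=
  steadySolution γ (boundaryInput f h x) 0 l

/-!
Multiplying by `exp (γ t)` removes the zeroth-order term and turns the growth condition into decay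
of the boundary datum like `exp (δ t)`, `δ = γ - γ₀ > 0`, as `t → -∞`. On a half line the heat
equation with such a datum `φ` is solved by the convolution of `φ` with the boundary heat kernel.
On the strip, the Neumann condition at `0` is met by reflection: the solution is the sum of the two
half-line solutions issuing from `1` and from `-1`, for a datum `φ` such that `φ` plus the value at
distance `2` of its half-line solution is the prescribed datum. Passing to distance `2` is a strict
contraction in the norm weighted by `exp (δ t)`, so `φ` is an alternating Neumann series. When the
datum is `C¹`, so is `φ`, because the correction at distance `2` is smooth, and then the half-line
solution is classical up to the boundary.

For uniqueness, the coefficient of a solution along `cos (μ l)` with `cos μ = 0` obeys a linear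
ordinary differential equation with rate `-(μ² + γ)` driven by the datum. The difference of two
solutions with the same datum thus has coefficients proportional to `exp (-(μ² + γ) t)`, which the
bound `C exp (-γ t)` forces to vanish, and these cosines are complete on `[0,1]` by
Stone–Weierstrass.

The flow commutes with time translations, so the steady solution attached to `X(a;x)` is the
translate by `a` of the one attached to `x`; hence the KKL mapping along the trajectory is this
single solution of the heat equation.
-/

section
open MeasureTheory Filter Topology Asymptotics

/-- `φ` is continuous and is `O(exp (δ t))` as `t → -∞`: the class of boundary data for which
the heat equation is solved on the half line. -/
structure HasExpDecay (δ : ℝ) (φ : ℝ → ℝ) : Prop where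
  continuous : Continuous φ
  isBigO : φ =O[atBot] fun t => Real.exp (δ * t)

variable {δ : ℝ} {φ ψ : ℝ → ℝ}

theorem HasExpDecay.of_forall_le {K : ℝ} (hφ : Continuous φ)
    (hK : ∀ t ≤ 0, |φ t| ≤ K * Real.exp (δ * t)) : HasExpDecay δ φ := by
  refine ⟨hφ, .of_bound K ?_⟩
  filter_upwards [eventually_le_atBot 0] with t ht
  simpa using hK t ht

theorem HasExpDecay.exists_bound (hφ : HasExpDecay δ φ) (T : ℝ) :
    ∃ K, 0 ≤ K ∧ ∀ t ≤ T, |φ t| ≤ K * Real.exp (δ * t) := by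
  obtain ⟨K₁, hK₁0, hK₁⟩ := hφ.isBigO.exists_nonneg
  obtain ⟨a, ha⟩ := eventually_atBot.1 hK₁.bound
  obtain ⟨K₂, hK₂⟩ := (isCompact_Icc (a := a) (b := T)).exists_bound_of_continuousOn
    (f := fun t => φ t * Real.exp (-(δ * t)))
    (hφ.continuous.mul (by fun_prop)).continuousOn
  refine ⟨max K₁ K₂, hK₁0.trans (le_max_left _ _), fun t ht => ?_⟩
  rcases le_total t a with hta | hat
  · calc |φ t| ≤ K₁ * Real.exp (δ * t) := by simpa using ha t hta
      _ ≤ max K₁ K₂ * Real.exp (δ * t) := by gcongr; exact le_max_left _ _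
  · have h := hK₂ t ⟨hat, ht⟩
    rw [Real.exp_neg, ← div_eq_mul_inv, norm_div, Real.norm_of_nonneg (Real.exp_pos _).le,
      div_le_iff₀ (Real.exp_pos _)] at h
    exact h.trans (by gcongr; exact le_max_right _ _)

theorem HasExpDecay.exists_bound_comp_sub (hδ : 0 < δ) (hφ : HasExpDecay δ φ) (T : ℝ) :
    ∃ K, ∀ t ≤ T, ∀ τ ≥ 0, |φ (t - τ)| ≤ K * Real.exp (-δ * τ) := by
  obtain ⟨K, hK0, hK⟩ := hφ.exists_bound T
  refine ⟨K * Real.exp (δ * T), fun t ht τ hτ => (hK _ (by linarith)).trans ?_⟩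
  rw [mul_assoc, ← Real.exp_add]
  gcongr
  nlinarith

theorem HasExpDecay.exists_bound_abs (hδ : 0 < δ) (hφ : HasExpDecay δ φ) (T : ℝ) :
    ∃ K, ∀ t ≤ T, |φ t| ≤ K := by
  obtain ⟨K, hK0, hK⟩ := hφ.exists_bound T
  refine ⟨K * Real.exp (δ * T), fun t ht => (hK t ht).trans ?_⟩
  gcongr

theorem HasExpDecay.sub (hφ : HasExpDecay δ φ) (hψ : HasExpDecay δ ψ) :
    HasExpDecay δ fun t => φ t - ψ t :=
  ⟨hφ.continuous.sub hψ.continuous, hφ.isBigO.sub hψ.isBigO⟩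

theorem HasExpDecay.of_eq_zero_on_Iic {a : ℝ} (hφ : Continuous φ) (hzero : ∀ t ≤ a, φ t = 0) :
    HasExpDecay δ φ := by
  refine ⟨hφ, (isBigO_zero _ _).congr' ?_ .rfl⟩
  filter_upwards [eventually_le_atBot a] with t ht using (hzero t ht).symm

/-- The primitive of `φ` that vanishes at `-∞`. -/
noncomputable def primitiveFromBot (φ : ℝ → ℝ) (t : ℝ) : ℝ := ∫ s in Iic t, φ s

theorem HasExpDecay.integrableOn_Iic (hδ : 0 < δ) (hφ : HasExpDecay δ φ) (t : ℝ) :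
    IntegrableOn φ (Iic t) := by
  obtain ⟨K, -, hK⟩ := hφ.exists_bound t
  exact ((integrableOn_exp_mul_Iic hδ t).const_mul K).mono' hφ.continuous.aestronglyMeasurable
    (ae_restrict_of_forall_mem measurableSet_Iic hK)

theorem HasExpDecay.hasDerivAt_primitiveFromBot (hδ : 0 < δ) (hφ : HasExpDecay δ φ) (t : ℝ) :
    HasDerivAt (primitiveFromBot φ) (φ t) t := by
  have h : primitiveFromBot φ = fun t => (∫ s in (0 : ℝ)..t, φ s) + ∫ s in Iic 0, φ s := by
    ext t
    rw [← intervalIntegral.integral_Iic_sub_Iic (hφ.integrableOn_Iic hδ 0)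
      (hφ.integrableOn_Iic hδ t), sub_add_cancel, primitiveFromBot]
  rw [h]
  exact (hφ.continuous.integral_hasStrictDerivAt 0 t).hasDerivAt.add_const _

theorem HasExpDecay.primitiveFromBot (hδ : 0 < δ) (hφ : HasExpDecay δ φ) :
    HasExpDecay δ (primitiveFromBot φ) := by
  obtain ⟨K, -, hK⟩ := hφ.exists_bound 0
  have hcont : Continuous (_root_.primitiveFromBot φ) :=
    continuous_iff_continuousAt.2 fun t => (hφ.hasDerivAt_primitiveFromBot hδ t).continuousAt
  refine .of_forall_le (K := K / δ) hcont fun t ht => ?_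
  calc |∫ s in Iic t, φ s| ≤ ∫ s in Iic t, K * Real.exp (δ * s) :=
        norm_integral_le_of_norm_le (f := φ) ((integrableOn_exp_mul_Iic hδ t).const_mul K)
          (ae_restrict_of_forall_mem measurableSet_Iic fun s hs => hK s (le_trans hs ht))
    _ = K / δ * Real.exp (δ * t) := by
        rw [integral_const_mul, integral_exp_mul_Iic hδ]
        ring

end

section
open MeasureTheory Filter Topology

/-- A kernel on the half line: continuous for positive times and positions, and bounded on
compact sets of positions, uniformly in time. -/
structure IsHalfLineKernel (k : ℝ → ℝ → ℝ) : Prop where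
  continuousOn : ContinuousOn (fun p : ℝ × ℝ => k p.1 p.2) (Ioi 0 ×ˢ Ioi 0)
  exists_bound : ∀ a b : ℝ, 0 < a → ∃ M : ℝ, ∀ τ > 0, ∀ y ∈ Icc a b, |k τ y| ≤ M

/-- The convolution in time of the kernel `k` with `φ`. -/
noncomputable def kernelIntegral (k : ℝ → ℝ → ℝ) (φ : ℝ → ℝ) (t y : ℝ) : ℝ :=
  ∫ τ in Ioi (0 : ℝ), k τ y * φ (t - τ)

variable {δ : ℝ} {φ : ℝ → ℝ} {k k' : ℝ → ℝ → ℝ}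

theorem integrableOn_const_mul_exp_neg_mul (hδ : 0 < δ) (K : ℝ) :
    IntegrableOn (fun τ : ℝ => K * Real.exp (-δ * τ)) (Ioi 0) :=
  (exp_neg_integrableOn_Ioi 0 hδ).const_mul K

theorem IsHalfLineKernel.const_mul (hk : IsHalfLineKernel k) (c : ℝ) :
    IsHalfLineKernel fun τ y => c * k τ y := by
  refine ⟨continuousOn_const.mul hk.continuousOn, fun a b ha => ?_⟩
  obtain ⟨M, hM⟩ := hk.exists_bound a b ha
  refine ⟨|c| * M, fun τ hτ y hy => ?_⟩
  rw [abs_mul]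
  gcongr
  exact hM τ hτ y hy

theorem IsHalfLineKernel.sub (hk : IsHalfLineKernel k) (hk' : IsHalfLineKernel k') :
    IsHalfLineKernel fun τ y => k τ y - k' τ y := by
  refine ⟨hk.continuousOn.sub hk'.continuousOn, fun a b ha => ?_⟩
  obtain ⟨M, hM⟩ := hk.exists_bound a b ha
  obtain ⟨M', hM'⟩ := hk'.exists_bound a b ha
  exact ⟨M + M', fun τ hτ y hy =>
    (abs_sub _ _).trans (add_le_add (hM τ hτ y hy) (hM' τ hτ y hy))⟩

theorem IsHalfLineKernel.aestronglyMeasurable (hk : IsHalfLineKernel k) (hφ : Continuous φ)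
    {y : ℝ} (hy : 0 < y) (t : ℝ) :
    AEStronglyMeasurable (fun τ => k τ y * φ (t - τ)) (volume.restrict (Ioi 0)) := by
  refine ContinuousOn.aestronglyMeasurable ?_ measurableSet_Ioi
  refine ContinuousOn.mul ?_ (by fun_prop)
  exact hk.continuousOn.comp (f := fun τ : ℝ => (τ, y)) (by fun_prop) fun τ hτ => ⟨hτ, hy⟩

theorem IsHalfLineKernel.exists_exp_bound (hδ : 0 < δ) (hk : IsHalfLineKernel k)
    (hφ : HasExpDecay δ φ) (T : ℝ) {a : ℝ} (b : ℝ) (ha : 0 < a) :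
    ∃ K : ℝ, ∀ t ≤ T, ∀ y ∈ Icc a b, ∀ τ > 0,
      |k τ y * φ (t - τ)| ≤ K * Real.exp (-δ * τ) := by
  obtain ⟨K, hK⟩ := hφ.exists_bound_comp_sub hδ T
  obtain ⟨M, hM⟩ := hk.exists_bound a b ha
  refine ⟨M * K, fun t ht y hy τ hτ => ?_⟩
  rw [abs_mul, mul_assoc]
  have hkM := hM τ hτ y hy
  exact mul_le_mul hkM (hK t ht τ hτ.le) (abs_nonneg _) ((abs_nonneg _).trans hkM)

theorem IsHalfLineKernel.integrableOn (hδ : 0 < δ) (hk : IsHalfLineKernel k)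
    (hφ : HasExpDecay δ φ) (t : ℝ) {y : ℝ} (hy : 0 < y) :
    IntegrableOn (fun τ => k τ y * φ (t - τ)) (Ioi 0) := by
  obtain ⟨K, hK⟩ := hk.exists_exp_bound hδ hφ t y hy
  exact (integrableOn_const_mul_exp_neg_mul hδ K).mono'
    (hk.aestronglyMeasurable hφ.continuous hy t)
    (ae_restrict_of_forall_mem measurableSet_Ioi (hK t le_rfl y ⟨le_rfl, le_rfl⟩))

theorem continuousOn_kernelIntegral (hδ : 0 < δ) (hk : IsHalfLineKernel k)
    (hφ : HasExpDecay δ φ) :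
    ContinuousOn (fun p : ℝ × ℝ => kernelIntegral k φ p.1 p.2) (univ ×ˢ Ioi 0) := by
  rintro ⟨t₀, y₀⟩ ⟨-, hy₀ : 0 < y₀⟩
  obtain ⟨K, hK⟩ := hk.exists_exp_bound hδ hφ (t₀ + 1) (y₀ + 1) (half_pos hy₀)
  have hnear : ∀ᶠ p : ℝ × ℝ in 𝓝 (t₀, y₀), p.1 ≤ t₀ + 1 ∧ p.2 ∈ Icc (y₀ / 2) (y₀ + 1) :=
    ((continuous_fst.tendsto _).eventually (Iic_mem_nhds (by simp))).and
      ((continuous_snd.tendsto _).eventually (Icc_mem_nhds (by simpa using hy₀) (by simp)))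
  refine ContinuousAt.continuousWithinAt ?_
  refine continuousAt_of_dominated (bound := fun τ => K * Real.exp (-δ * τ)) ?_ ?_
    (integrableOn_const_mul_exp_neg_mul hδ K) ?_
  · filter_upwards [hnear] with p hp
    exact hk.aestronglyMeasurable hφ.continuous ((half_pos hy₀).trans_le hp.2.1) p.1
  · filter_upwards [hnear] with p hp
    exact ae_restrict_of_forall_mem measurableSet_Ioi (hK _ hp.1 _ hp.2)
  · refine ae_restrict_of_forall_mem measurableSet_Ioi fun τ hτ => ?_
    have hcont : ContinuousAt (fun p : ℝ × ℝ => k p.1 p.2) (τ, y₀) :=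
      hk.continuousOn.continuousAt ((isOpen_Ioi.prod isOpen_Ioi).mem_nhds ⟨hτ, hy₀⟩)
    exact (ContinuousAt.comp (f := fun p : ℝ × ℝ => (τ, p.2)) (x := (t₀, y₀)) hcont
      (by fun_prop)).mul (hφ.continuous.comp (by fun_prop)).continuousAt

theorem hasDerivAt_kernelIntegral_space (hδ : 0 < δ) (hk : IsHalfLineKernel k)
    (hk' : IsHalfLineKernel k') (hkk' : ∀ τ > 0, ∀ y > 0, HasDerivAt (k τ) (k' τ y) y)
    (hφ : HasExpDecay δ φ) (t : ℝ) {y : ℝ} (hy : 0 < y) :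
    HasDerivAt (fun z => kernelIntegral k φ t z) (kernelIntegral k' φ t y) y := by
  obtain ⟨K, hK⟩ := hk'.exists_exp_bound hδ hφ t (y + 1) (half_pos hy)
  have hs : Icc (y / 2) (y + 1) ∈ 𝓝 y := Icc_mem_nhds (by linarith) (by linarith)
  refine (hasDerivAt_integral_of_dominated_loc_of_deriv_le
    (F := fun z τ => k τ z * φ (t - τ)) (F' := fun z τ => k' τ z * φ (t - τ))
    (bound := fun τ => K * Real.exp (-δ * τ)) hs ?_ (hk.integrableOn hδ hφ t hy)
    (hk'.aestronglyMeasurable hφ.continuous hy t) ?_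
    (integrableOn_const_mul_exp_neg_mul hδ K) ?_).2
  · filter_upwards [Ioi_mem_nhds hy] with z hz using hk.aestronglyMeasurable hφ.continuous hz t
  · exact ae_restrict_of_forall_mem measurableSet_Ioi fun τ hτ z hz => hK _ le_rfl _ hz τ hτ
  · exact ae_restrict_of_forall_mem measurableSet_Ioi fun τ hτ z hz =>
      (hkk' τ hτ z ((half_pos hy).trans_le hz.1)).mul_const _

theorem hasDerivAt_kernelIntegral_time (hδ : 0 < δ) (hk : IsHalfLineKernel k) {Φ : ℝ → ℝ}
    (hΦ : HasExpDecay δ Φ) (hφ : HasExpDecay δ φ) (hΦφ : ∀ t, HasDerivAt Φ (φ t) t)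
    (t : ℝ) {y : ℝ} (hy : 0 < y) :
    HasDerivAt (fun s => kernelIntegral k Φ s y) (kernelIntegral k φ t y) t := by
  obtain ⟨K, hK⟩ := hk.exists_exp_bound hδ hφ (t + 1) y hy
  refine (hasDerivAt_integral_of_dominated_loc_of_deriv_le
    (F := fun s τ => k τ y * Φ (s - τ)) (F' := fun s τ => k τ y * φ (s - τ))
    (bound := fun τ => K * Real.exp (-δ * τ)) (Iic_mem_nhds (lt_add_one t)) ?_
    (hk.integrableOn hδ hΦ t hy) (hk.aestronglyMeasurable hφ.continuous hy t) ?_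
    (integrableOn_const_mul_exp_neg_mul hδ K) ?_).2
  · exact .of_forall fun s => hk.aestronglyMeasurable hΦ.continuous hy s
  · exact ae_restrict_of_forall_mem measurableSet_Ioi fun τ hτ s hs =>
      hK _ hs _ ⟨le_rfl, le_rfl⟩ τ hτ
  · exact .of_forall fun τ s _ => ((hΦφ (s - τ)).comp_sub_const s τ).const_mul _

end

section
open Filter Topology

/-- The Gaussian factor of the heat kernels, with the factor `τ ^ (-3/2)`. -/
noncomputable def gaussFactor (τ y : ℝ) : ℝ :=
  (2 * Real.sqrt Real.pi)⁻¹ * τ ^ (-(3 / 2) : ℝ) * Real.exp (-(y ^ 2 / (4 * τ)))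

/-- The Poisson kernel of the heat equation on a half line. -/
noncomputable def boundaryKernel (τ y : ℝ) : ℝ := y * gaussFactor τ y

/-- The derivative in `y` of `boundaryKernel`. -/
noncomputable def boundaryKernelDy (τ y : ℝ) : ℝ := (1 - y ^ 2 / (2 * τ)) * gaussFactor τ y

/-- The second derivative in `y`, and the derivative in `τ`, of `boundaryKernel`. -/
noncomputable def boundaryKernelDyy (τ y : ℝ) : ℝ :=
  (y ^ 3 / (4 * τ ^ 2) - 3 * y / (2 * τ)) * gaussFactor τ y

variable {τ : ℝ}

theorem gaussFactor_nonneg (hτ : 0 ≤ τ) (y : ℝ) : 0 ≤ gaussFactor τ y := by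
  unfold gaussFactor
  positivity

theorem hasDerivAt_gaussFactor_space (τ y : ℝ) :
    HasDerivAt (gaussFactor τ) (-(y / (2 * τ)) * gaussFactor τ y) y := by
  have hexp : HasDerivAt (fun y : ℝ => -(y ^ 2 / (4 * τ))) (-(y / (2 * τ))) y := by
    refine (((hasDerivAt_pow 2 y).div_const (4 * τ)).neg).congr_deriv ?_
    push_cast
    ring
  refine (hexp.exp.const_mul ((2 * Real.sqrt Real.pi)⁻¹ * τ ^ (-(3 / 2) : ℝ))).congr_deriv ?_
  unfold gaussFactor
  ring

theorem hasDerivAt_gaussFactor_time (hτ : 0 < τ) (y : ℝ) :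
    HasDerivAt (fun τ => gaussFactor τ y)
      ((y ^ 2 / (4 * τ ^ 2) - 3 / (2 * τ)) * gaussFactor τ y) τ := by
  have hexp : HasDerivAt (fun τ : ℝ => -(y ^ 2 / (4 * τ))) (y ^ 2 / (4 * τ ^ 2)) τ := by
    refine (((hasDerivAt_const τ (y ^ 2)).fun_div ((hasDerivAt_id τ).const_mul 4)
      (by simpa using hτ.ne')).fun_neg).congr_deriv ?_
    simp only [id]
    field_simp
    ring
  have hpow : HasDerivAt (fun τ : ℝ => τ ^ (-(3 / 2) : ℝ))
      (-(3 / (2 * τ)) * τ ^ (-(3 / 2) : ℝ)) τ := by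
    refine (Real.hasDerivAt_rpow_const (p := -(3 / 2)) (Or.inl hτ.ne')).congr_deriv ?_
    rw [Real.rpow_sub_one hτ.ne']
    field_simp
  refine ((hpow.const_mul (2 * Real.sqrt Real.pi)⁻¹).mul hexp.exp).congr_deriv ?_
  unfold gaussFactor
  ring

theorem hasDerivAt_boundaryKernel_space (τ y : ℝ) :
    HasDerivAt (boundaryKernel τ) (boundaryKernelDy τ y) y := by
  refine ((hasDerivAt_id y).mul (hasDerivAt_gaussFactor_space τ y)).congr_deriv ?_
  simp only [boundaryKernelDy, id]
  ring

theorem hasDerivAt_boundaryKernelDy_space (τ y : ℝ) :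
    HasDerivAt (boundaryKernelDy τ) (boundaryKernelDyy τ y) y := by
  have hpoly : HasDerivAt (fun y : ℝ => 1 - y ^ 2 / (2 * τ)) (-(y / τ)) y := by
    refine (((hasDerivAt_pow 2 y).div_const (2 * τ)).const_sub 1).congr_deriv ?_
    push_cast
    ring
  refine (hpoly.mul (hasDerivAt_gaussFactor_space τ y)).congr_deriv ?_
  simp only [boundaryKernelDyy]
  ring

theorem hasDerivAt_boundaryKernel_time (hτ : 0 < τ) (y : ℝ) :
    HasDerivAt (fun τ => boundaryKernel τ y) (boundaryKernelDyy τ y) τ := by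
  refine ((hasDerivAt_gaussFactor_time hτ y).const_mul y).congr_deriv ?_
  simp only [boundaryKernelDyy]
  ring

theorem pow_mul_exp_neg_mul_le {c z : ℝ} (hc : 0 < c) (hz : 0 ≤ z) (m : ℕ) :
    z ^ m * Real.exp (-(c * z)) ≤ m.factorial / c ^ m := by
  have h := Real.pow_div_factorial_le_exp (c * z) (by positivity) m
  rw [div_le_iff₀ (by positivity)] at h
  rw [Real.exp_neg, ← div_eq_mul_inv, div_le_div_iff₀ (Real.exp_pos _) (by positivity)]
  linarith [mul_pow c z m]

theorem rpow_neg_three_halves_le (hτ : 0 < τ) : τ ^ (-(3 / 2) : ℝ) ≤ 1 + τ⁻¹ ^ 2 := by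
  rw [Real.rpow_neg hτ.le, ← Real.inv_rpow hτ.le]
  have hinv : 0 < τ⁻¹ := inv_pos.2 hτ
  rcases le_total τ⁻¹ 1 with h | h
  · linarith [Real.rpow_le_one hinv.le h (by norm_num : (0 : ℝ) ≤ 3 / 2), sq_nonneg τ⁻¹]
  · have := Real.rpow_le_rpow_of_exponent_le h (by norm_num : (3 / 2 : ℝ) ≤ 2)
    rw [Real.rpow_two] at this
    linarith

theorem exists_gaussFactor_div_pow_le {a : ℝ} (ha : 0 < a) (j : ℕ) :
    ∃ M : ℝ, ∀ τ > 0, ∀ y ≥ a, gaussFactor τ y / τ ^ j ≤ M := by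
  set c := a ^ 2 / 4 with hc
  have hc0 : 0 < c := by positivity
  refine ⟨(2 * Real.sqrt Real.pi)⁻¹ * (j.factorial / c ^ j + (j + 2).factorial / c ^ (j + 2)),
    fun τ hτ y hy => ?_⟩
  have hinv : 0 ≤ τ⁻¹ := inv_nonneg.2 hτ.le
  have hexp : Real.exp (-(y ^ 2 / (4 * τ))) ≤ Real.exp (-(c * τ⁻¹)) := by
    apply Real.exp_le_exp.2
    rw [hc, neg_le_neg_iff, ← div_eq_mul_inv, div_div]
    gcongr
  calc gaussFactor τ y / τ ^ j
      = (2 * Real.sqrt Real.pi)⁻¹ *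
          ((τ⁻¹ ^ j * τ ^ (-(3 / 2) : ℝ)) * Real.exp (-(y ^ 2 / (4 * τ)))) := by
        unfold gaussFactor
        rw [inv_pow]
        ring
    _ ≤ (2 * Real.sqrt Real.pi)⁻¹ *
          ((τ⁻¹ ^ j * (1 + τ⁻¹ ^ 2)) * Real.exp (-(c * τ⁻¹))) := by
        gcongr
        exact rpow_neg_three_halves_le hτ
    _ = (2 * Real.sqrt Real.pi)⁻¹ * (τ⁻¹ ^ j * Real.exp (-(c * τ⁻¹)) +
          τ⁻¹ ^ (j + 2) * Real.exp (-(c * τ⁻¹))) := by ring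
    _ ≤ _ := by
        gcongr
        · exact pow_mul_exp_neg_mul_le hc0 hinv j
        · exact pow_mul_exp_neg_mul_le hc0 hinv (j + 2)

theorem continuousOn_gaussFactor :
    ContinuousOn (fun p : ℝ × ℝ => gaussFactor p.1 p.2) (Ioi 0 ×ˢ univ) := by
  rintro ⟨τ, y⟩ ⟨hτ : 0 < τ, -⟩
  refine ContinuousAt.continuousWithinAt ?_
  have hpow : ContinuousAt (fun p : ℝ × ℝ => p.1 ^ (-(3 / 2) : ℝ)) (τ, y) :=
    continuousAt_fst.rpow_const (Or.inl hτ.ne')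
  have hexp : ContinuousAt (fun p : ℝ × ℝ => p.2 ^ 2 / (4 * p.1)) (τ, y) :=
    ContinuousAt.div (by fun_prop) (by fun_prop) (by simpa using hτ.ne')
  exact (continuousAt_const.mul hpow).mul hexp.neg.rexp

theorem isHalfLineKernel_pow_mul_gaussFactor_div_pow (i j : ℕ) :
    IsHalfLineKernel fun τ y => y ^ i * (gaussFactor τ y / τ ^ j) := by
  constructor
  · refine (continuous_snd.pow i).continuousOn.mul ?_
    exact (continuousOn_gaussFactor.mono (prod_mono_right (subset_univ _))).div
      (by fun_prop) fun p hp => pow_ne_zero j (ne_of_gt hp.1)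
  intro a b ha
  obtain ⟨M, hM⟩ := exists_gaussFactor_div_pow_le ha j
  refine ⟨b ^ i * M, fun τ hτ y hy => ?_⟩
  have hy0 : 0 ≤ y := ha.le.trans hy.1
  have hg : 0 ≤ gaussFactor τ y / τ ^ j := div_nonneg (gaussFactor_nonneg hτ.le y) (by positivity)
  rw [abs_of_nonneg (by positivity)]
  exact mul_le_mul (pow_le_pow_left₀ hy0 hy.2 i) (hM τ hτ y hy.1) hg
    (pow_nonneg (hy0.trans hy.2) i)

theorem isHalfLineKernel_boundaryKernel : IsHalfLineKernel boundaryKernel := by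
  convert isHalfLineKernel_pow_mul_gaussFactor_div_pow 1 0 using 3 with τ y
  unfold boundaryKernel
  ring

theorem isHalfLineKernel_boundaryKernelDy : IsHalfLineKernel boundaryKernelDy := by
  convert (isHalfLineKernel_pow_mul_gaussFactor_div_pow 0 0).sub
    ((isHalfLineKernel_pow_mul_gaussFactor_div_pow 2 1).const_mul (1 / 2)) using 3 with τ y
  unfold boundaryKernelDy
  ring

theorem isHalfLineKernel_boundaryKernelDyy : IsHalfLineKernel boundaryKernelDyy := by
  convert ((isHalfLineKernel_pow_mul_gaussFactor_div_pow 3 2).const_mul (1 / 4)).sub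
    ((isHalfLineKernel_pow_mul_gaussFactor_div_pow 1 1).const_mul (3 / 2)) using 3 with τ y
  unfold boundaryKernelDyy
  ring

theorem tendsto_boundaryKernel_zero {y : ℝ} (hy : 0 < y) :
    Tendsto (fun τ => boundaryKernel τ y) (𝓝[>] 0) (𝓝 0) := by
  obtain ⟨M, hM⟩ := exists_gaussFactor_div_pow_le hy 1
  have hlim : Tendsto (fun τ : ℝ => y * (M * τ)) (𝓝[>] 0) (𝓝 0) := by
    have : Tendsto (fun τ : ℝ => y * (M * τ)) (𝓝 0) (𝓝 (y * (M * 0))) :=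
      Continuous.tendsto (by fun_prop) 0
    simpa using this.mono_left nhdsWithin_le_nhds
  refine squeeze_zero' ?_ ?_ hlim
  · filter_upwards [self_mem_nhdsWithin] with τ hτ
    exact mul_nonneg hy.le (gaussFactor_nonneg (le_of_lt hτ) y)
  · filter_upwards [self_mem_nhdsWithin] with τ hτ
    have := hM τ hτ y le_rfl
    rw [pow_one, div_le_iff₀ hτ] at this
    exact mul_le_mul_of_nonneg_left this hy.le

end

section
open MeasureTheory Filter Topology

variable {δ : ℝ} {φ g Φ : ℝ → ℝ}

/-- The integrand of `halfLineSolution`: the Poisson kernel convolution after the substitution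
`τ = (y / (2 σ))²`, in which form it makes sense at `y = 0` too. -/
noncomputable def halfLineIntegrand (φ : ℝ → ℝ) (t y σ : ℝ) : ℝ :=
  φ (t - (y / (2 * σ)) ^ 2) * Real.exp (-σ ^ 2)

/-- The solution of the heat equation on the half line `y ≥ 0` with boundary datum `φ`. -/
noncomputable def halfLineSolution (φ : ℝ → ℝ) (t y : ℝ) : ℝ :=
  2 / Real.sqrt Real.pi * ∫ σ in Ioi (0 : ℝ), halfLineIntegrand φ t y σ

theorem integrable_exp_neg_sq : Integrable fun σ : ℝ => Real.exp (-σ ^ 2) := by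
  simpa using integrable_exp_neg_mul_sq (b := 1) one_pos

theorem integral_Ioi_exp_neg_sq :
    ∫ σ in Ioi (0 : ℝ), Real.exp (-σ ^ 2) = Real.sqrt Real.pi / 2 := by
  simpa using integral_gaussian_Ioi 1

theorem halfLineSolution_const (c t y : ℝ) : halfLineSolution (fun _ => c) t y = c := by
  have hpi : Real.sqrt Real.pi ≠ 0 := (Real.sqrt_pos.2 Real.pi_pos).ne'
  simp only [halfLineSolution, halfLineIntegrand]
  rw [integral_const_mul, integral_Ioi_exp_neg_sq]
  field_simp

theorem halfLineSolution_zero (φ : ℝ → ℝ) (t : ℝ) : halfLineSolution φ t 0 = φ t := by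
  simpa [halfLineSolution, halfLineIntegrand] using halfLineSolution_const (φ t) t 0

theorem abs_halfLineIntegrand_le {t : ℝ} (hφg : ∀ s ≤ t, |φ s| ≤ g s) (y σ : ℝ) :
    |halfLineIntegrand φ t y σ| ≤ halfLineIntegrand g t y σ := by
  rw [halfLineIntegrand, abs_mul, abs_of_pos (Real.exp_pos _)]
  exact mul_le_mul_of_nonneg_right (hφg _ (sub_le_self t (sq_nonneg _))) (Real.exp_pos _).le

theorem continuousOn_halfLineIntegrand (hφ : Continuous φ) (t y : ℝ) :
    ContinuousOn (halfLineIntegrand φ t y) (Ioi 0) := by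
  refine ContinuousOn.mul (hφ.comp_continuousOn ?_) (by fun_prop)
  exact continuousOn_const.sub ((continuousOn_const.div (by fun_prop)
    fun σ hσ => mul_ne_zero two_ne_zero (ne_of_gt hσ)).pow 2)

theorem aestronglyMeasurable_halfLineIntegrand (hφ : Continuous φ) (t y : ℝ) :
    AEStronglyMeasurable (halfLineIntegrand φ t y) (volume.restrict (Ioi 0)) :=
  (continuousOn_halfLineIntegrand hφ t y).aestronglyMeasurable measurableSet_Ioi

theorem integrableOn_halfLineIntegrand (hφ : Continuous φ) {K t : ℝ} (hK : ∀ s ≤ t, |φ s| ≤ K)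
    (y : ℝ) : IntegrableOn (halfLineIntegrand φ t y) (Ioi 0) :=
  (integrable_exp_neg_sq.integrableOn.const_mul K).mono'
    (aestronglyMeasurable_halfLineIntegrand hφ t y)
    (.of_forall (abs_halfLineIntegrand_le hK y))

theorem continuous_halfLineSolution (hφ : Continuous φ)
    (hbdd : ∀ T : ℝ, ∃ K : ℝ, ∀ t ≤ T, |φ t| ≤ K) :
    Continuous fun p : ℝ × ℝ => halfLineSolution φ p.1 p.2 := by
  refine continuous_const.mul (continuous_iff_continuousAt.2 fun p₀ => ?_)
  obtain ⟨K, hK⟩ := hbdd (p₀.1 + 1)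
  refine continuousAt_of_dominated (bound := fun σ => K * Real.exp (-σ ^ 2)) ?_ ?_
    (integrable_exp_neg_sq.integrableOn.const_mul K) ?_
  · exact .of_forall fun p => aestronglyMeasurable_halfLineIntegrand hφ p.1 p.2
  · filter_upwards [(continuous_fst.tendsto p₀).eventually (Iic_mem_nhds (lt_add_one _))] with p hp
    exact .of_forall (abs_halfLineIntegrand_le (fun s hs => hK s (hs.trans hp)) p.2)
  · refine .of_forall fun σ => Continuous.continuousAt ?_
    exact (hφ.comp (by fun_prop)).mul_const _

theorem HasExpDecay.continuous_halfLineSolution (hδ : 0 < δ) (hφ : HasExpDecay δ φ) :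
    Continuous fun p : ℝ × ℝ => halfLineSolution φ p.1 p.2 :=
  _root_.continuous_halfLineSolution hφ.continuous (hφ.exists_bound_abs hδ)

theorem abs_halfLineSolution_le {t y : ℝ} (hg : IntegrableOn (halfLineIntegrand g t y) (Ioi 0))
    (hφg : ∀ s ≤ t, |φ s| ≤ g s) : |halfLineSolution φ t y| ≤ halfLineSolution g t y := by
  rw [halfLineSolution, abs_mul, abs_of_nonneg (by positivity)]
  exact mul_le_mul_of_nonneg_left
    (norm_integral_le_of_norm_le (f := halfLineIntegrand φ t y) hg
      (.of_forall (abs_halfLineIntegrand_le hφg y))) (by positivity)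

theorem abs_halfLineSolution_le_const {K t : ℝ} (hK : ∀ s ≤ t, |φ s| ≤ K) (y : ℝ) :
    |halfLineSolution φ t y| ≤ K :=
  (abs_halfLineSolution_le (g := fun _ => K) (integrable_exp_neg_sq.integrableOn.const_mul K)
    hK).trans_eq (halfLineSolution_const K t y)

/-- The factor by which the half line solution operator at distance `y` contracts the norm with
weight `exp (δ t)`. -/
noncomputable def contractionFactor (δ y : ℝ) : ℝ :=
  halfLineSolution (fun t => Real.exp (δ * t)) 0 y

theorem halfLineSolution_const_mul_exp (K δ t y : ℝ) :
    halfLineSolution (fun s => K * Real.exp (δ * s)) t y =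
      contractionFactor δ y * (K * Real.exp (δ * t)) := by
  have hshift : ∀ σ, halfLineIntegrand (fun s => K * Real.exp (δ * s)) t y σ =
      K * Real.exp (δ * t) * halfLineIntegrand (fun s => Real.exp (δ * s)) 0 y σ := by
    intro σ
    simp only [halfLineIntegrand]
    rw [mul_sub, sub_eq_add_neg, Real.exp_add, zero_sub, mul_neg]
    ring
  simp only [contractionFactor, halfLineSolution, hshift, integral_const_mul]
  ring

theorem integrableOn_halfLineIntegrand_exp (hδ : 0 ≤ δ) (K t y : ℝ) :
    IntegrableOn (halfLineIntegrand (fun s => K * Real.exp (δ * s)) t y) (Ioi 0) := by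
  refine integrableOn_halfLineIntegrand (by fun_prop) (K := |K| * Real.exp (δ * t))
    (fun s hs => ?_) y
  rw [abs_mul, Real.abs_exp]
  gcongr

theorem contractionFactor_nonneg (δ y : ℝ) : 0 ≤ contractionFactor δ y := by
  unfold contractionFactor halfLineSolution halfLineIntegrand
  positivity

theorem setIntegral_lt_setIntegral {α : Type*} [MeasurableSpace α] {μ : Measure α} {s : Set α}
    {f g : α → ℝ} (hs : MeasurableSet s) (hμs : μ s ≠ 0) (hf : IntegrableOn f s μ)
    (hg : IntegrableOn g s μ) (hfg : ∀ x ∈ s, f x < g x) :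
    ∫ x in s, f x ∂μ < ∫ x in s, g x ∂μ := by
  rw [← sub_pos, ← integral_sub hg hf, setIntegral_pos_iff_support_of_nonneg_ae
    (ae_restrict_of_forall_mem hs fun x hx => (sub_pos.2 (hfg x hx)).le) (hg.sub hf)]
  exact (pos_iff_ne_zero.2 hμs).trans_le
    (measure_mono fun x hx => ⟨(sub_pos.2 (hfg x hx)).ne', hx⟩)

theorem contractionFactor_lt_one (hδ : 0 < δ) {y : ℝ} (hy : y ≠ 0) :
    contractionFactor δ y < 1 := by
  rw [← halfLineSolution_const 1 0 y]
  refine mul_lt_mul_of_pos_left ?_ (by positivity)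
  refine setIntegral_lt_setIntegral measurableSet_Ioi (by simp)
    (by simpa using integrableOn_halfLineIntegrand_exp hδ.le 1 0 y)
    (integrable_exp_neg_sq.integrableOn.const_mul 1) fun σ (hσ : 0 < σ) => ?_
  refine mul_lt_mul_of_pos_right (Real.exp_lt_one_iff.2 ?_) (Real.exp_pos _)
  rw [zero_sub, mul_neg, neg_lt_zero]
  positivity

theorem abs_halfLineSolution_le_contractionFactor_mul (hδ : 0 ≤ δ) {K t : ℝ}
    (hK : ∀ s ≤ t, |φ s| ≤ K * Real.exp (δ * s)) (y : ℝ) :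
    |halfLineSolution φ t y| ≤ contractionFactor δ y * (K * Real.exp (δ * t)) :=
  (abs_halfLineSolution_le (integrableOn_halfLineIntegrand_exp hδ K t y) hK).trans_eq
    (halfLineSolution_const_mul_exp K δ t y)

theorem HasExpDecay.comp_halfLineSolution (hδ : 0 < δ) (hφ : HasExpDecay δ φ) (y : ℝ) :
    HasExpDecay δ fun t => halfLineSolution φ t y := by
  obtain ⟨K, -, hK⟩ := hφ.exists_bound 0
  refine .of_forall_le (K := contractionFactor δ y * K)
    ((hφ.continuous_halfLineSolution hδ).comp (by fun_prop : Continuous fun t => (t, y)))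
    fun t ht => ?_
  rw [mul_assoc]
  exact abs_halfLineSolution_le_contractionFactor_mul hδ.le (fun s hs => hK s (hs.trans ht)) y

theorem halfLineSolution_eq_kernelIntegral (φ : ℝ → ℝ) (t : ℝ) {y : ℝ} (hy : 0 < y) :
    halfLineSolution φ t y = kernelIntegral boundaryKernel φ t y := by
  have hscale := integral_comp_mul_left_Ioi' (halfLineIntegrand φ t y) 0 (half_pos hy)
  have hpower := integral_comp_rpow_Ioi (fun x => halfLineIntegrand φ t y (y / 2 * x))
    (p := -(1 / 2)) (by norm_num)
  rw [mul_zero] at hscale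
  rw [halfLineSolution, ← hscale, ← hpower, smul_eq_mul, ← integral_const_mul,
    ← integral_const_mul, kernelIntegral]
  refine setIntegral_congr_fun measurableSet_Ioi fun τ (hτ : 0 < τ) => ?_
  have hpos : 0 < τ ^ (-(1 / 2) : ℝ) := Real.rpow_pos_of_pos hτ _
  have hsq : (τ ^ (-(1 / 2) : ℝ)) ^ 2 = τ⁻¹ := by
    rw [← Real.rpow_natCast, ← Real.rpow_mul hτ.le, ← Real.rpow_neg_one]
    norm_num
  have htime : (y / (2 * (y / 2 * τ ^ (-(1 / 2) : ℝ)))) ^ 2 = τ := by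
    rw [show y / (2 * (y / 2 * τ ^ (-(1 / 2) : ℝ))) = (τ ^ (-(1 / 2) : ℝ))⁻¹ by
        field_simp [hpos.ne'],
      inv_pow, hsq, inv_inv]
  have hexponent : -(y / 2 * τ ^ (-(1 / 2) : ℝ)) ^ 2 = -(y ^ 2 / (4 * τ)) := by
    rw [mul_pow, hsq]
    ring
  simp only [halfLineIntegrand, htime, hexponent, boundaryKernel, gaussFactor, smul_eq_mul]
  rw [show (-(1 / 2) - 1 : ℝ) = -(3 / 2) by norm_num, abs_neg, abs_of_pos (by norm_num)]
  field_simp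

theorem kernelIntegral_boundaryKernelDyy_of_hasDerivAt (hδ : 0 < δ) (hΦ : HasExpDecay δ Φ)
    (hφ : HasExpDecay δ φ) (hΦφ : ∀ t, HasDerivAt Φ (φ t) t) (t : ℝ) {y : ℝ} (hy : 0 < y) :
    kernelIntegral boundaryKernelDyy Φ t y = kernelIntegral boundaryKernel φ t y := by
  have hderiv : ∀ τ ∈ Ioi (0 : ℝ), HasDerivAt (fun τ => Φ (t - τ)) (-φ (t - τ)) τ :=
    fun τ _ => (hΦφ (t - τ)).comp_const_sub t τ
  have hint : IntegrableOn (fun τ => boundaryKernel τ y * -φ (t - τ)) (Ioi 0) :=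
    (isHalfLineKernel_boundaryKernel.integrableOn hδ hφ t hy).neg.congr_fun
      (fun τ _ => (mul_neg _ _).symm) measurableSet_Ioi
  have hlim_zero : Tendsto (fun τ => boundaryKernel τ y * Φ (t - τ)) (𝓝[>] 0) (𝓝 0) := by
    simpa using (tendsto_boundaryKernel_zero hy).mul
      ((hΦ.continuous.tendsto' _ _ rfl).comp
        ((Continuous.tendsto (by fun_prop : Continuous fun τ => t - τ) 0).mono_left
          nhdsWithin_le_nhds))
  have hlim_top : Tendsto (fun τ => boundaryKernel τ y * Φ (t - τ)) atTop (𝓝 0) := by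
    obtain ⟨K, hK⟩ := isHalfLineKernel_boundaryKernel.exists_exp_bound hδ hΦ t y hy
    have hexp : Tendsto (fun τ : ℝ => K * Real.exp (-δ * τ)) atTop (𝓝 0) := by
      simpa using (Real.tendsto_exp_atBot.comp
        (tendsto_id.const_mul_atTop_of_neg (neg_lt_zero.2 hδ))).const_mul K
    refine squeeze_zero_norm' ?_ hexp
    filter_upwards [eventually_gt_atTop 0] with τ hτ using hK t le_rfl y ⟨le_rfl, le_rfl⟩ τ hτ
  have hparts := integral_Ioi_mul_deriv_eq_deriv_mul
    (fun τ hτ => hasDerivAt_boundaryKernel_time hτ y) hderiv hint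
    (isHalfLineKernel_boundaryKernelDyy.integrableOn hδ hΦ t hy) hlim_zero hlim_top
  simp only [mul_neg, integral_neg, sub_zero, zero_sub, neg_inj] at hparts
  exact hparts.symm

theorem hasDerivAt_halfLineSolution_time (hδ : 0 < δ) (hφ : HasExpDecay δ φ) (t : ℝ)
    {y : ℝ} (hy : 0 < y) :
    HasDerivAt (fun s => halfLineSolution φ s y) (kernelIntegral boundaryKernelDyy φ t y) t := by
  have hprim := hφ.hasDerivAt_primitiveFromBot hδ
  have heq : (fun s => halfLineSolution φ s y) =
      fun s => kernelIntegral boundaryKernelDyy (primitiveFromBot φ) s y := by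
    ext s
    rw [halfLineSolution_eq_kernelIntegral φ s hy,
      kernelIntegral_boundaryKernelDyy_of_hasDerivAt hδ (hφ.primitiveFromBot hδ) hφ hprim s hy]
  rw [heq]
  exact hasDerivAt_kernelIntegral_time hδ isHalfLineKernel_boundaryKernelDyy
    (hφ.primitiveFromBot hδ) hφ hprim t hy

theorem hasDerivAt_halfLineSolution_space (hδ : 0 < δ) (hφ : HasExpDecay δ φ) (t : ℝ)
    {y : ℝ} (hy : 0 < y) :
    HasDerivAt (halfLineSolution φ t) (kernelIntegral boundaryKernelDy φ t y) y := by
  refine (hasDerivAt_kernelIntegral_space hδ isHalfLineKernel_boundaryKernel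
    isHalfLineKernel_boundaryKernelDy (fun τ _ y _ => hasDerivAt_boundaryKernel_space τ y)
    hφ t hy).congr_of_eventuallyEq ?_
  filter_upwards [Ioi_mem_nhds hy] with z hz using halfLineSolution_eq_kernelIntegral φ t hz

theorem hasDerivAt_kernelIntegral_boundaryKernelDy (hδ : 0 < δ) (hφ : HasExpDecay δ φ) (t : ℝ)
    {y : ℝ} (hy : 0 < y) :
    HasDerivAt (kernelIntegral boundaryKernelDy φ t) (kernelIntegral boundaryKernelDyy φ t y) y :=
  hasDerivAt_kernelIntegral_space hδ isHalfLineKernel_boundaryKernelDy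
    isHalfLineKernel_boundaryKernelDyy (fun τ _ y _ => hasDerivAt_boundaryKernelDy_space τ y)
    hφ t hy

end

section
open MeasureTheory Filter Topology

variable {δ : ℝ} {φ ψ : ℝ → ℝ}

theorem exists_contDiff_hasExpDecay_eqOn_Ici (δ : ℝ) (hφ : ContDiff ℝ 1 φ) (a : ℝ) :
    ∃ ψ : ℝ → ℝ, ContDiff ℝ 1 ψ ∧ HasExpDecay δ ψ ∧ HasExpDecay δ (deriv ψ) ∧
      EqOn ψ φ (Ici a) := by
  set ψ : ℝ → ℝ := fun s => Real.smoothTransition (s - (a - 1)) * φ s with hψ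
  have hdiff : ContDiff ℝ 1 ψ := (Real.smoothTransition.contDiff.comp (by fun_prop)).mul hφ
  have hzero : ∀ s ≤ a - 1, ψ s = 0 := fun s hs => by
    simp only [hψ, Real.smoothTransition.zero_of_nonpos (sub_nonpos.2 hs), zero_mul]
  have hderiv_zero : ∀ s ≤ a - 2, deriv ψ s = 0 := fun s hs => by
    have hlocal : ψ =ᶠ[𝓝 s] fun _ => 0 := by
      filter_upwards [Iic_mem_nhds (by linarith : s < a - 1)] with r hr using hzero r hr
    rw [hlocal.deriv_eq, deriv_const]
  refine ⟨ψ, hdiff, .of_eq_zero_on_Iic hdiff.continuous hzero,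
    .of_eq_zero_on_Iic (hdiff.continuous_deriv le_rfl) hderiv_zero, fun s (hs : a ≤ s) => ?_⟩
  simp only [hψ, Real.smoothTransition.one_of_one_le (by linarith : 1 ≤ s - (a - 1)), one_mul]

theorem gaussFactor_le_of_one_le {τ : ℝ} (hτ : 1 ≤ τ) (y : ℝ) :
    gaussFactor τ y ≤ (2 * Real.sqrt Real.pi)⁻¹ := by
  rw [gaussFactor, mul_assoc]
  refine mul_le_of_le_one_right (by positivity) (mul_le_one₀
    (Real.rpow_le_one_of_one_le_of_nonpos hτ (by norm_num)) (Real.exp_pos _).le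
    (Real.exp_le_one_iff.2 (neg_nonpos.2 (by positivity))))

theorem abs_boundaryKernelDyy_le_of_one_le {τ y : ℝ} (hτ : 1 ≤ τ) (hy : 0 ≤ y) :
    |boundaryKernelDyy τ y| ≤ (y ^ 3 / 4 + 3 * y / 2) * (2 * Real.sqrt Real.pi)⁻¹ := by
  have hg := gaussFactor_nonneg (by linarith : 0 ≤ τ) y
  rw [boundaryKernelDyy, abs_mul, abs_of_nonneg hg]
  refine mul_le_mul ((abs_sub _ _).trans ?_) (gaussFactor_le_of_one_le hτ y) hg (by positivity)
  rw [abs_of_nonneg (by positivity), abs_of_nonneg (by positivity)]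
  gcongr ?_ + ?_
  · exact div_le_div_of_nonneg_left (by positivity) (by norm_num) (by nlinarith)
  · exact div_le_div_of_nonneg_left (by positivity) (by norm_num) (by linarith)

theorem exists_abs_kernelIntegral_boundaryKernelDyy_le (hδ : 0 < δ) (hφ : HasExpDecay δ φ)
    {T : ℝ} (hzero : ∀ t ≥ T, φ t = 0) (T' : ℝ) :
    ∃ K : ℝ, ∀ t ∈ Icc (T + 1) T', ∀ y ≥ 0,
      |kernelIntegral boundaryKernelDyy φ t y| ≤ (y ^ 3 / 4 + 3 * y / 2) * K := by
  obtain ⟨K, hK⟩ := hφ.exists_bound_comp_sub hδ T'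
  refine ⟨∫ τ in Ioi (0 : ℝ), (2 * Real.sqrt Real.pi)⁻¹ * (K * Real.exp (-δ * τ)),
    fun t ht y hy => ?_⟩
  rw [← integral_const_mul]
  refine norm_integral_le_of_norm_le (f := fun τ => boundaryKernelDyy τ y * φ (t - τ))
    (((integrableOn_const_mul_exp_neg_mul hδ K).const_mul _).const_mul _)
    (ae_restrict_of_forall_mem measurableSet_Ioi fun τ (hτ : 0 < τ) => ?_)
  have hbound := hK t ht.2 τ hτ.le
  have hnonneg := (abs_nonneg _).trans hbound
  rcases le_total τ 1 with hτ1 | hτ1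
  · rw [hzero (t - τ) (by linarith [ht.1]), mul_zero, norm_zero]
    positivity
  · rw [Real.norm_eq_abs, abs_mul, ← mul_assoc]
    exact mul_le_mul (abs_boundaryKernelDyy_le_of_one_le hτ1 hy) hbound (abs_nonneg _)
      (by positivity)

/-- The second space derivative of the half line solution with a `C¹` datum `φ`, extended to
`y ≤ 0` by its boundary value `deriv φ t`. -/
noncomputable def halfLineDyy (φ : ℝ → ℝ) (t y : ℝ) : ℝ :=
  if 0 < y then kernelIntegral boundaryKernelDyy φ t y else deriv φ t

theorem halfLineDyy_of_pos (φ : ℝ → ℝ) (t : ℝ) {y : ℝ} (hy : 0 < y) :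
    halfLineDyy φ t y = kernelIntegral boundaryKernelDyy φ t y := if_pos hy

theorem halfLineDyy_of_nonpos (φ : ℝ → ℝ) (t : ℝ) {y : ℝ} (hy : y ≤ 0) :
    halfLineDyy φ t y = deriv φ t := if_neg hy.not_gt

theorem kernelIntegral_boundaryKernelDyy_zero (φ : ℝ → ℝ) (t : ℝ) :
    kernelIntegral boundaryKernelDyy φ t 0 = 0 := by
  simp [kernelIntegral, boundaryKernelDyy]

/- Only the values of `φ` near time `t` are singular for the kernel, and for these the derivatives
can be moved from the kernel to the datum. -/
theorem halfLineDyy_eq_add (hδ : 0 < δ) (hφ : HasExpDecay δ φ) (hψ : HasExpDecay δ ψ)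
    (hψ_diff : Differentiable ℝ ψ) (hψ' : HasExpDecay δ (deriv ψ)) {t : ℝ}
    (hlocal : ψ =ᶠ[𝓝 t] φ) (y : ℝ) :
    halfLineDyy φ t y = halfLineSolution (deriv ψ) t (max y 0) +
      kernelIntegral boundaryKernelDyy (fun s => φ s - ψ s) t (max y 0) := by
  rcases lt_or_ge 0 y with hy | hy
  · rw [halfLineDyy_of_pos φ t hy, max_eq_left hy.le, halfLineSolution_eq_kernelIntegral _ t hy,
      ← kernelIntegral_boundaryKernelDyy_of_hasDerivAt hδ hψ hψ'
        (fun s => (hψ_diff s).hasDerivAt) t hy, kernelIntegral, kernelIntegral, kernelIntegral,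
      ← integral_add (isHalfLineKernel_boundaryKernelDyy.integrableOn hδ hψ t hy)
        (isHalfLineKernel_boundaryKernelDyy.integrableOn hδ (hφ.sub hψ) t hy)]
    congr 1 with τ
    ring
  · rw [halfLineDyy_of_nonpos φ t hy, max_eq_right hy, halfLineSolution_zero,
      kernelIntegral_boundaryKernelDyy_zero, hlocal.deriv_eq, add_zero]

theorem continuousAt_halfLineDyy_of_nonpos (hδ : 0 < δ) (hφ : HasExpDecay δ φ)
    (hφ1 : ContDiff ℝ 1 φ) (t₀ : ℝ) {y₀ : ℝ} (hy₀ : y₀ ≤ 0) :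
    ContinuousAt (fun p : ℝ × ℝ => halfLineDyy φ p.1 p.2) (t₀, y₀) := by
  obtain ⟨ψ, hψ1, hψ, hψ', hψφ⟩ := exists_contDiff_hasExpDecay_eqOn_Ici δ hφ1 (t₀ - 2)
  obtain ⟨K, hK⟩ := exists_abs_kernelIntegral_boundaryKernelDyy_le hδ (hφ.sub hψ)
    (T := t₀ - 2) (fun s hs => sub_eq_zero.2 (hψφ hs).symm) (t₀ + 1)
  have htime : ∀ᶠ p : ℝ × ℝ in 𝓝 (t₀, y₀), p.1 ∈ Icc (t₀ - 1) (t₀ + 1) :=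
    (continuous_fst.tendsto _).eventually (Icc_mem_nhds (by simp) (by simp))
  have hnear : ContinuousAt (fun p : ℝ × ℝ => halfLineSolution (deriv ψ) p.1 (max p.2 0))
      (t₀, y₀) :=
    ((hψ'.continuous_halfLineSolution hδ).comp
      (by fun_prop : Continuous fun p : ℝ × ℝ => (p.1, max p.2 0))).continuousAt
  have hfar : ContinuousAt (fun p : ℝ × ℝ =>
      kernelIntegral boundaryKernelDyy (fun s => φ s - ψ s) p.1 (max p.2 0)) (t₀, y₀) := by
    have hlim : Tendsto (fun p : ℝ × ℝ => (max p.2 0 ^ 3 / 4 + 3 * max p.2 0 / 2) * K)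
        (𝓝 (t₀, y₀)) (𝓝 0) :=
      Continuous.tendsto' (by fun_prop) _ _ (by simp [max_eq_right hy₀])
    rw [ContinuousAt, max_eq_right hy₀, kernelIntegral_boundaryKernelDyy_zero]
    refine squeeze_zero_norm' ?_ hlim
    filter_upwards [htime] with p hp
    exact hK p.1 ⟨by linarith [hp.1], hp.2⟩ _ (le_max_right _ _)
  refine (hnear.add hfar).congr ?_
  filter_upwards [htime] with p hp
  refine (halfLineDyy_eq_add hδ hφ hψ (hψ1.differentiable one_ne_zero) hψ' ?_ p.2).symm
  filter_upwards [Ici_mem_nhds (by linarith [hp.1] : t₀ - 2 < p.1)] with s hs using hψφ hs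

theorem continuous_halfLineDyy (hδ : 0 < δ) (hφ : HasExpDecay δ φ) (hφ1 : ContDiff ℝ 1 φ) :
    Continuous fun p : ℝ × ℝ => halfLineDyy φ p.1 p.2 := by
  refine continuous_iff_continuousAt.2 fun ⟨t₀, y₀⟩ => ?_
  rcases le_or_gt y₀ 0 with hy₀ | hy₀
  · exact continuousAt_halfLineDyy_of_nonpos hδ hφ hφ1 t₀ hy₀
  have hnhds : (univ : Set ℝ) ×ˢ Ioi (0 : ℝ) ∈ 𝓝 (t₀, y₀) :=
    (isOpen_univ.prod isOpen_Ioi).mem_nhds ⟨trivial, hy₀⟩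
  refine ((continuousOn_kernelIntegral hδ isHalfLineKernel_boundaryKernelDyy hφ).continuousAt
    hnhds).congr ?_
  filter_upwards [hnhds] with p hp using (halfLineDyy_of_pos φ p.1 hp.2).symm

/-- The space derivative of the half line solution with a `C¹` datum, as a primitive of
`halfLineDyy` so that it extends to the boundary `y = 0`. -/
noncomputable def halfLineDy (φ : ℝ → ℝ) (t y : ℝ) : ℝ :=
  kernelIntegral boundaryKernelDy φ t 1 + ∫ z in (1 : ℝ)..y, halfLineDyy φ t z

theorem hasDerivAt_halfLineDy (hδ : 0 < δ) (hφ : HasExpDecay δ φ) (hφ1 : ContDiff ℝ 1 φ)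
    (t y : ℝ) : HasDerivAt (halfLineDy φ t) (halfLineDyy φ t y) y :=
  (((continuous_halfLineDyy hδ hφ hφ1).comp (Continuous.prodMk_right t)).integral_hasStrictDerivAt
    1 y).hasDerivAt.const_add _

theorem continuous_halfLineDy (hδ : 0 < δ) (hφ : HasExpDecay δ φ) (hφ1 : ContDiff ℝ 1 φ) :
    Continuous fun p : ℝ × ℝ => halfLineDy φ p.1 p.2 := by
  refine Continuous.add ?_ ?_
  · exact (continuousOn_kernelIntegral hδ isHalfLineKernel_boundaryKernelDy hφ).comp_continuous
      (f := fun p : ℝ × ℝ => (p.1, 1)) (by fun_prop) fun _ => ⟨trivial, mem_Ioi.2 one_pos⟩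
  · exact intervalIntegral.continuous_parametric_intervalIntegral_of_continuous
      (f := fun (p : ℝ × ℝ) z => halfLineDyy φ p.1 z)
      ((continuous_halfLineDyy hδ hφ hφ1).comp
        (by fun_prop : Continuous fun q : (ℝ × ℝ) × ℝ => (q.1.1, q.2))) continuous_snd

theorem halfLineDy_of_pos (hδ : 0 < δ) (hφ : HasExpDecay δ φ) (hφ1 : ContDiff ℝ 1 φ) (t : ℝ)
    {y : ℝ} (hy : 0 < y) : halfLineDy φ t y = kernelIntegral boundaryKernelDy φ t y := by
  rw [halfLineDy, intervalIntegral.integral_eq_sub_of_hasDerivAt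
    (f := kernelIntegral boundaryKernelDy φ t), add_sub_cancel]
  · intro z hz
    have hz0 : 0 < z := (lt_min one_pos hy).trans_le hz.1
    rw [halfLineDyy_of_pos φ t hz0]
    exact hasDerivAt_kernelIntegral_boundaryKernelDy hδ hφ t hz0
  · exact ((continuous_halfLineDyy hδ hφ hφ1).comp
      (Continuous.prodMk_right t)).intervalIntegrable _ _

theorem hasDerivWithinAt_halfLineSolution_space (hδ : 0 < δ) (hφ : HasExpDecay δ φ)
    (hφ1 : ContDiff ℝ 1 φ) (t : ℝ) {y : ℝ} (hy : 0 ≤ y) :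
    HasDerivWithinAt (halfLineSolution φ t) (halfLineDy φ t y) (Ici 0) y := by
  have hpos : ∀ z > 0, HasDerivAt (halfLineSolution φ t) (halfLineDy φ t z) z := fun z hz => by
    rw [halfLineDy_of_pos hδ hφ hφ1 t hz]
    exact hasDerivAt_halfLineSolution_space hδ hφ t hz
  rcases hy.lt_or_eq with hy | rfl
  · exact (hpos y hy).hasDerivWithinAt
  refine hasDerivWithinAt_Ici_of_tendsto_deriv (s := Ioi 0)
    (fun z hz => (hpos z hz).differentiableAt.differentiableWithinAt)
    ((hφ.continuous_halfLineSolution hδ).comp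
      (Continuous.prodMk_right t)).continuousWithinAt self_mem_nhdsWithin ?_
  refine Tendsto.congr' ?_
    ((hasDerivAt_halfLineDy hδ hφ hφ1 t 0).continuousAt.tendsto.mono_left nhdsWithin_le_nhds)
  filter_upwards [self_mem_nhdsWithin] with z hz using (hpos z hz).deriv.symm

theorem hasDerivAt_halfLineSolution_time_of_contDiff (hδ : 0 < δ) (hφ : HasExpDecay δ φ)
    (hφ1 : ContDiff ℝ 1 φ) (t : ℝ) {y : ℝ} (hy : 0 ≤ y) :
    HasDerivAt (fun s => halfLineSolution φ s y) (halfLineDyy φ t y) t := by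
  rcases hy.lt_or_eq with hy | rfl
  · rw [halfLineDyy_of_pos φ t hy]
    exact hasDerivAt_halfLineSolution_time hδ hφ t hy
  · simp only [halfLineSolution_zero, halfLineDyy_of_nonpos φ t le_rfl]
    exact (hφ1.differentiable one_ne_zero t).hasDerivAt

end

section

/-- `G` solves the heat equation for all times at the points of `Y`, where `Gy` and `Gyy` are its
first and second space derivatives (within `Y`) and are continuous. -/
structure IsCaloricOn (G Gy Gyy : ℝ → ℝ → ℝ) (Y : Set ℝ) : Prop where
  continuousOn_space : ContinuousOn (fun p : ℝ × ℝ => Gy p.1 p.2) (univ ×ˢ Y)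
  continuousOn_space_space : ContinuousOn (fun p : ℝ × ℝ => Gyy p.1 p.2) (univ ×ˢ Y)
  hasDerivAt_time : ∀ t, ∀ y ∈ Y, HasDerivAt (fun s => G s y) (Gyy t y) t
  hasDerivWithinAt_space : ∀ t, ∀ y ∈ Y, HasDerivWithinAt (G t) (Gy t y) Y y
  hasDerivWithinAt_space_space : ∀ t, ∀ y ∈ Y, HasDerivWithinAt (Gy t) (Gyy t y) Y y

variable {G Gy Gyy H Hy Hyy : ℝ → ℝ → ℝ} {Y S : Set ℝ}

theorem IsCaloricOn.add (hG : IsCaloricOn G Gy Gyy Y) (hH : IsCaloricOn H Hy Hyy Y) :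
    IsCaloricOn (fun t y => G t y + H t y) (fun t y => Gy t y + Hy t y)
      (fun t y => Gyy t y + Hyy t y) Y where
  continuousOn_space := hG.continuousOn_space.add hH.continuousOn_space
  continuousOn_space_space := hG.continuousOn_space_space.add hH.continuousOn_space_space
  hasDerivAt_time t y hy := (hG.hasDerivAt_time t y hy).add (hH.hasDerivAt_time t y hy)
  hasDerivWithinAt_space t y hy :=
    (hG.hasDerivWithinAt_space t y hy).add (hH.hasDerivWithinAt_space t y hy)
  hasDerivWithinAt_space_space t y hy :=
    (hG.hasDerivWithinAt_space_space t y hy).add (hH.hasDerivWithinAt_space_space t y hy)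

theorem IsCaloricOn.comp_const_add (hG : IsCaloricOn G Gy Gyy Y) {c : ℝ}
    (hS : MapsTo (fun l => c + l) S Y) :
    IsCaloricOn (fun t l => G t (c + l)) (fun t l => Gy t (c + l)) (fun t l => Gyy t (c + l))
      S := by
  have hmaps : MapsTo (fun p : ℝ × ℝ => (p.1, c + p.2)) (univ ×ˢ S) (univ ×ˢ Y) :=
    fun p hp => ⟨trivial, hS hp.2⟩
  have hderiv : ∀ {g : ℝ → ℝ} {g' l : ℝ}, HasDerivWithinAt g g' Y (c + l) →
      HasDerivWithinAt (fun r => g (c + r)) g' S l := fun {g g' l} hg => by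
    simpa [Function.comp_def] using hg.comp l ((hasDerivWithinAt_id l S).const_add c) hS
  exact ⟨hG.continuousOn_space.comp (by fun_prop) hmaps,
    hG.continuousOn_space_space.comp (by fun_prop) hmaps,
    fun t l hl => hG.hasDerivAt_time t _ (hS hl),
    fun t l hl => hderiv (hG.hasDerivWithinAt_space t _ (hS hl)),
    fun t l hl => hderiv (hG.hasDerivWithinAt_space_space t _ (hS hl))⟩

theorem IsCaloricOn.comp_const_sub (hG : IsCaloricOn G Gy Gyy Y) {c : ℝ}
    (hS : MapsTo (fun l => c - l) S Y) :
    IsCaloricOn (fun t l => G t (c - l)) (fun t l => -Gy t (c - l)) (fun t l => Gyy t (c - l))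
      S := by
  have hmaps : MapsTo (fun p : ℝ × ℝ => (p.1, c - p.2)) (univ ×ˢ S) (univ ×ˢ Y) :=
    fun p hp => ⟨trivial, hS hp.2⟩
  have hderiv : ∀ {g : ℝ → ℝ} {g' l : ℝ}, HasDerivWithinAt g g' Y (c - l) →
      HasDerivWithinAt (fun r => g (c - r)) (-g') S l := fun {g g' l} hg => by
    simpa [Function.comp_def] using hg.comp l ((hasDerivWithinAt_id l S).const_sub c) hS
  exact ⟨(hG.continuousOn_space.comp (by fun_prop) hmaps).neg,
    hG.continuousOn_space_space.comp (by fun_prop) hmaps,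
    fun t l hl => hG.hasDerivAt_time t _ (hS hl),
    fun t l hl => hderiv (hG.hasDerivWithinAt_space t _ (hS hl)),
    fun t l hl => by
      simpa only [neg_neg] using (hderiv (hG.hasDerivWithinAt_space_space t _ (hS hl))).fun_neg⟩

theorem IsCaloricOn.isHeatSolution (hG : IsCaloricOn G Gy Gyy S)
    (hcont : ContinuousOn (fun p : ℝ × ℝ => G p.1 p.2) (univ ×ˢ Icc 0 1))
    (hneumann : ∀ t, Gy t 0 = 0) : IsHeatSolution 0 univ S (fun t => G t 1) G where
  continuousOn := hcont
  heat_neumann := ⟨Gyy, Gy, Gyy, hG.continuousOn_space_space, hG.continuousOn_space,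
    hG.continuousOn_space_space, fun t _ l hl => ⟨(hG.hasDerivAt_time t l hl).hasDerivWithinAt,
      hG.hasDerivWithinAt_space t l hl, hG.hasDerivWithinAt_space_space t l hl, by simp⟩,
    fun t _ => hneumann t⟩
  dirichlet _ _ := rfl

variable {δ : ℝ} {φ : ℝ → ℝ}

theorem HasExpDecay.isCaloricOn_Ioi (hδ : 0 < δ) (hφ : HasExpDecay δ φ) :
    IsCaloricOn (halfLineSolution φ) (kernelIntegral boundaryKernelDy φ)
      (kernelIntegral boundaryKernelDyy φ) (Ioi 0) where
  continuousOn_space := continuousOn_kernelIntegral hδ isHalfLineKernel_boundaryKernelDy hφ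
  continuousOn_space_space := continuousOn_kernelIntegral hδ isHalfLineKernel_boundaryKernelDyy hφ
  hasDerivAt_time t _ hy := hasDerivAt_halfLineSolution_time hδ hφ t hy
  hasDerivWithinAt_space t _ hy := (hasDerivAt_halfLineSolution_space hδ hφ t hy).hasDerivWithinAt
  hasDerivWithinAt_space_space t _ hy :=
    (hasDerivAt_kernelIntegral_boundaryKernelDy hδ hφ t hy).hasDerivWithinAt

theorem HasExpDecay.isCaloricOn_Ici (hδ : 0 < δ) (hφ : HasExpDecay δ φ) (hφ1 : ContDiff ℝ 1 φ) :
    IsCaloricOn (halfLineSolution φ) (halfLineDy φ) (halfLineDyy φ) (Ici 0) where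
  continuousOn_space := (continuous_halfLineDy hδ hφ hφ1).continuousOn
  continuousOn_space_space := (continuous_halfLineDyy hδ hφ hφ1).continuousOn
  hasDerivAt_time t _ hy := hasDerivAt_halfLineSolution_time_of_contDiff hδ hφ hφ1 t hy
  hasDerivWithinAt_space t _ hy := hasDerivWithinAt_halfLineSolution_space hδ hφ hφ1 t hy
  hasDerivWithinAt_space_space t y _ := (hasDerivAt_halfLineDy hδ hφ hφ1 t y).hasDerivWithinAt

end

section
open MeasureTheory Filter Topology

variable {δ : ℝ} {φ U : ℝ → ℝ} {a : ℕ → ℝ → ℝ} {c : ℕ → ℝ}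

theorem HasExpDecay.tsum (hδ : 0 ≤ δ) (ha : ∀ n, Continuous (a n)) (hc : Summable c)
    (hbound : ∀ T, ∃ K, ∀ n, ∀ t ≤ T, |a n t| ≤ c n * (K * Real.exp (δ * t))) :
    HasExpDecay δ fun t => ∑' n, a n t := by
  have hcont : Continuous fun t => ∑' n, a n t := by
    refine continuous_iff_continuousAt.2 fun t => ?_
    obtain ⟨K, hK⟩ := hbound (t + 1)
    refine (continuousOn_tsum (s := Iic (t + 1)) (fun n => (ha n).continuousOn)
      (hc.abs.mul_right (|K| * Real.exp (δ * (t + 1)))) fun n s hs => ?_).continuousAt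
      (Iic_mem_nhds (lt_add_one t))
    calc |a n s| ≤ |c n * (K * Real.exp (δ * s))| := (hK n s hs).trans (le_abs_self _)
      _ = |c n| * (|K| * Real.exp (δ * s)) := by rw [abs_mul, abs_mul, Real.abs_exp]
      _ ≤ _ := by gcongr; exact hs
  obtain ⟨K, hK⟩ := hbound 0
  refine .of_forall_le (K := (∑' n, c n) * K) hcont fun t ht => ?_
  rw [mul_assoc]
  exact tsum_of_norm_bounded (f := fun n => a n t) (hc.hasSum.mul_right _) fun n => hK n t ht

theorem halfLineSolution_tsum {t : ℝ} (ha : ∀ n, Continuous (a n)) (hc : Summable c)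
    (hbound : ∀ n, ∀ s ≤ t, |a n s| ≤ c n) (y : ℝ) :
    halfLineSolution (fun s => ∑' n, a n s) t y = ∑' n, halfLineSolution (a n) t y := by
  have hsummable : ∀ s ≤ t, Summable fun n => a n s := fun s hs =>
    hc.of_norm_bounded fun n => hbound n s hs
  have hsum := hasSum_integral_of_dominated_convergence (μ := volume.restrict (Ioi 0))
    (F := fun n => halfLineIntegrand (a n) t y)
    (f := halfLineIntegrand (fun s => ∑' n, a n s) t y)
    (fun n σ => c n * Real.exp (-σ ^ 2))
    (fun n => aestronglyMeasurable_halfLineIntegrand (ha n) t y)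
    (fun n => .of_forall (abs_halfLineIntegrand_le (hbound n) y))
    (.of_forall fun σ => hc.mul_right _)
    (by simpa only [tsum_mul_right] using integrable_exp_neg_sq.integrableOn.const_mul _)
    (.of_forall fun σ => (hsummable _ (sub_le_self t (sq_nonneg _))).hasSum.mul_right _)
  simp only [halfLineSolution]
  rw [← hsum.tsum_eq, tsum_mul_left]

/-- The iterates of the operator that maps `φ` to minus its half line solution at distance `2`:
the terms of the Neumann series for the equation `φ + halfLineSolution φ · 2 = U`. -/
noncomputable def iteratedReflection (U : ℝ → ℝ) : ℕ → ℝ → ℝ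
  | 0 => U
  | n + 1 => fun t => -halfLineSolution (iteratedReflection U n) t 2

theorem HasExpDecay.continuous_iteratedReflection (hδ : 0 < δ) (hU : HasExpDecay δ U) (n : ℕ) :
    Continuous (iteratedReflection U n) := by
  suffices HasExpDecay δ (iteratedReflection U n) from this.continuous
  induction n with
  | zero => exact hU
  | succ n ih =>
    have hnext := ih.comp_halfLineSolution hδ 2
    exact ⟨hnext.continuous.neg, hnext.isBigO.neg_left⟩

theorem abs_iteratedReflection_le (hδ : 0 ≤ δ) {K T : ℝ}
    (hK : ∀ t ≤ T, |U t| ≤ K * Real.exp (δ * t)) (n : ℕ) :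
    ∀ t ≤ T, |iteratedReflection U n t| ≤ contractionFactor δ 2 ^ n * (K * Real.exp (δ * t)) := by
  induction n with
  | zero => simpa [iteratedReflection] using hK
  | succ n ih =>
    intro t ht
    rw [iteratedReflection, abs_neg, pow_succ', mul_assoc, ← mul_assoc _ K]
    exact abs_halfLineSolution_le_contractionFactor_mul hδ
      (fun s hs => by simpa only [mul_assoc] using ih s (hs.trans ht)) 2

theorem exists_add_halfLineSolution_eq (hδ : 0 < δ) (hU : HasExpDecay δ U) :
    ∃ φ : ℝ → ℝ, HasExpDecay δ φ ∧ ∀ t, φ t + halfLineSolution φ t 2 = U t := by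
  have hgeom : Summable fun n : ℕ => contractionFactor δ 2 ^ n :=
    summable_geometric_of_lt_one (contractionFactor_nonneg δ 2)
      (contractionFactor_lt_one hδ two_ne_zero)
  have hcont := hU.continuous_iteratedReflection hδ
  refine ⟨fun t => ∑' n, iteratedReflection U n t, .tsum hδ.le hcont hgeom fun T => ?_,
    fun t => ?_⟩
  · obtain ⟨K, -, hK⟩ := hU.exists_bound T
    exact ⟨K, abs_iteratedReflection_le hδ.le hK⟩
  obtain ⟨K, hK0, hK⟩ := hU.exists_bound t
  have hbound : ∀ n, ∀ s ≤ t, |iteratedReflection U n s| ≤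
      contractionFactor δ 2 ^ n * (K * Real.exp (δ * t)) := fun n s hs =>
    (abs_iteratedReflection_le hδ.le hK n s hs).trans (by
      have := contractionFactor_nonneg δ 2
      gcongr)
  have hsum : Summable fun n => iteratedReflection U n t :=
    (hgeom.mul_right _).of_norm_bounded fun n => hbound n t le_rfl
  beta_reduce
  rw [halfLineSolution_tsum hcont (hgeom.mul_right _) hbound, hsum.tsum_eq_zero_add]
  simp only [iteratedReflection, tsum_neg, neg_add_cancel_right]

/-- The solution on `0 ≤ l ≤ 1` obtained from half line solutions with sources at `l = 1` and
`l = -1`; by symmetry it has no flux at `l = 0`. -/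
noncomputable def stripSolution (φ : ℝ → ℝ) (t l : ℝ) : ℝ :=
  halfLineSolution φ t (1 - l) + halfLineSolution φ t (1 + l)

theorem isHeatSolution_stripSolution (hδ : 0 < δ) (hφ : HasExpDecay δ φ) {Gy Gyy : ℝ → ℝ → ℝ}
    {S Y : Set ℝ} (hG : IsCaloricOn (halfLineSolution φ) Gy Gyy Y)
    (hsub : MapsTo (fun l => 1 - l) S Y) (hadd : MapsTo (fun l => 1 + l) S Y) :
    IsHeatSolution 0 univ S (fun t => φ t + halfLineSolution φ t 2) (stripSolution φ) := by
  have hcont := hφ.continuous_halfLineSolution hδ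
  have hboundary : (fun t => φ t + halfLineSolution φ t 2) = fun t => stripSolution φ t 1 := by
    ext t
    rw [stripSolution, sub_self, halfLineSolution_zero, one_add_one_eq_two]
  rw [hboundary]
  refine ((hG.comp_const_sub hsub).add (hG.comp_const_add hadd)).isHeatSolution
    (Continuous.continuousOn ?_) fun t => by rw [sub_zero, add_zero, neg_add_cancel]
  exact (hcont.comp (by fun_prop : Continuous fun p : ℝ × ℝ => (p.1, 1 - p.2))).add
    (hcont.comp (by fun_prop : Continuous fun p : ℝ × ℝ => (p.1, 1 + p.2)))

theorem HasExpDecay.contDiff_of_add_halfLineSolution_eq (hδ : 0 < δ) (hφ : HasExpDecay δ φ)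
    (hU : ContDiff ℝ 1 U) {y : ℝ} (hy : 0 < y) (hφU : ∀ t, φ t + halfLineSolution φ t y = U t) :
    ContDiff ℝ 1 φ := by
  have hderiv : ∀ t, HasDerivAt φ (deriv U t - kernelIntegral boundaryKernelDyy φ t y) t :=
    fun t => ((hU.differentiable one_ne_zero t).hasDerivAt.sub
      (hasDerivAt_halfLineSolution_time hδ hφ t hy)).congr_of_eventuallyEq
      (.of_forall fun s => eq_sub_of_add_eq (hφU s))
  have hcont : Continuous fun t => kernelIntegral boundaryKernelDyy φ t y :=
    (continuousOn_kernelIntegral hδ isHalfLineKernel_boundaryKernelDyy hφ).comp_continuous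
      (f := fun t : ℝ => (t, y)) (by fun_prop) fun _ => ⟨trivial, hy⟩
  refine contDiff_one_iff_deriv.2 ⟨fun t => (hderiv t).differentiableAt, ?_⟩
  rw [funext fun t => (hderiv t).deriv]
  exact (hU.continuous_deriv le_rfl).sub hcont

theorem exists_isHeatSolution_zero_univ (hδ : 0 < δ) (hU : HasExpDecay δ U) :
    ∃ v : ℝ → ℝ → ℝ, IsHeatSolution 0 univ (Ico 0 1) U v ∧
      (ContDiff ℝ 1 U → IsHeatSolution 0 univ (Icc 0 1) U v) ∧
      ∀ T : ℝ, ∃ K : ℝ, ∀ t ≤ T, ∀ l, |v t l| ≤ K := by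
  obtain ⟨φ, hφ, hφU⟩ := exists_add_halfLineSolution_eq hδ hU
  obtain rfl : (fun t => φ t + halfLineSolution φ t 2) = U := funext hφU
  refine ⟨stripSolution φ, ?_, fun hU1 => ?_, fun T => ?_⟩
  · exact isHeatSolution_stripSolution hδ hφ (hφ.isCaloricOn_Ioi hδ)
      (fun l hl => sub_pos.2 hl.2) fun l hl => add_pos_of_pos_of_nonneg one_pos hl.1
  · have hφ1 := hφ.contDiff_of_add_halfLineSolution_eq hδ hU1 two_pos hφU
    exact isHeatSolution_stripSolution hδ hφ (hφ.isCaloricOn_Ici hδ hφ1)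
      (fun l hl => sub_nonneg.2 hl.2) fun l hl => add_nonneg zero_le_one hl.1
  · obtain ⟨K, hK⟩ := hφ.exists_bound_abs hδ T
    have hbound : ∀ t ≤ T, ∀ y, |halfLineSolution φ t y| ≤ K := fun t ht =>
      abs_halfLineSolution_le_const fun s hs => hK s (hs.trans ht)
    exact ⟨K + K, fun t ht l => (abs_add_le _ _).trans
      (add_le_add (hbound t ht _) (hbound t ht _))⟩

end

section
open MeasureTheory Polynomial

variable {s : Set ℝ} {F W c : ℝ → ℝ} {a b : ℝ}

theorem exists_polynomial_comp_near (hs : IsCompact s) (hF : ContinuousOn F s)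
    (hc : ContinuousOn c s) (hinj : InjOn c s) {ε : ℝ} (hε : 0 < ε) :
    ∃ p : ℝ[X], ∀ x ∈ s, |p.eval (c x) - F x| < ε := by
  have := isCompact_iff_compactSpace.1 hs
  let φ : C(s, ℝ) := ⟨s.domRestrict c, hc.domRestrict⟩
  have hsep : (Algebra.adjoin ℝ {φ}).SeparatesPoints := fun x y hxy =>
    ⟨φ, ⟨φ, Algebra.self_mem_adjoin_singleton ℝ φ, rfl⟩,
      fun h => hxy (Subtype.ext (hinj x.2 y.2 h))⟩
  obtain ⟨⟨g, hg⟩, hnear⟩ :=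
    ContinuousMap.exists_mem_subalgebra_near_continuous_of_separatesPoints _ hsep
      (s.domRestrict F) hF.domRestrict ε hε
  rw [Algebra.adjoin_singleton_eq_range_aeval] at hg
  obtain ⟨p, rfl⟩ := hg
  refine ⟨p, fun x hx => ?_⟩
  have hval : aeval φ p ⟨x, hx⟩ = p.eval (c x) := aeval_continuousMap_apply p φ ⟨x, hx⟩
  rw [← hval]
  exact hnear ⟨x, hx⟩

theorem integral_mul_polynomial_eq_zero (hab : a ≤ b) (hW : ContinuousOn W (Icc a b))
    (hc : ContinuousOn c (Icc a b)) (h : ∀ j : ℕ, ∫ x in a..b, W x * c x ^ j = 0) (p : ℝ[X]) :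
    ∫ x in a..b, W x * p.eval (c x) = 0 := by
  have hint (q : ℝ[X]) : IntervalIntegrable (fun x => W x * q.eval (c x)) volume a b :=
    (hW.mul (q.continuous.comp_continuousOn hc)).intervalIntegrable_of_Icc hab
  induction p using Polynomial.induction_on' with
  | add p q hp hq =>
    simp only [eval_add, mul_add]
    rw [intervalIntegral.integral_add (hint p) (hint q), hp, hq, add_zero]
  | monomial j r =>
    simp only [eval_monomial, mul_left_comm _ r, intervalIntegral.integral_const_mul, h, mul_zero]

theorem eqOn_zero_of_integral_mul_pow_eq_zero (hab : a < b) (hW : ContinuousOn W (Icc a b))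
    (hc : ContinuousOn c (Icc a b)) (hinj : InjOn c (Icc a b))
    (h : ∀ j : ℕ, ∫ x in a..b, W x * c x ^ j = 0) : EqOn W 0 (Icc a b) := by
  obtain ⟨M, hM⟩ := isCompact_Icc.exists_bound_of_continuousOn hW
  have hM0 : 0 ≤ M := (norm_nonneg _).trans (hM a ⟨le_rfl, hab.le⟩)
  have hsq_le (ε : ℝ) (hε : 0 < ε) : ∫ x in a..b, W x ^ 2 ≤ ε * (M * (b - a)) := by
    obtain ⟨p, hp⟩ := exists_polynomial_comp_near isCompact_Icc hW hc hinj hε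
    have hWp : ContinuousOn (fun x => W x * p.eval (c x)) (Icc a b) :=
      hW.mul (p.continuous.comp_continuousOn hc)
    have hsplit : ∫ x in a..b, W x ^ 2 = ∫ x in a..b, (W x ^ 2 - W x * p.eval (c x)) := by
      rw [intervalIntegral.integral_sub
        (ContinuousOn.intervalIntegrable_of_Icc hab.le (by fun_prop))
        (hWp.intervalIntegrable_of_Icc hab.le), integral_mul_polynomial_eq_zero hab.le hW hc h,
        sub_zero]
    have hbound : ∀ x ∈ uIoc a b, ‖W x ^ 2 - W x * p.eval (c x)‖ ≤ M * ε := fun x hx => by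
      have hx' : x ∈ Icc a b := Ioc_subset_Icc_self (uIoc_of_le hab.le ▸ hx)
      rw [sq, ← mul_sub, norm_mul, Real.norm_eq_abs (_ - _), abs_sub_comm]
      exact mul_le_mul (hM x hx') (hp x hx').le (abs_nonneg _) hM0
    calc ∫ x in a..b, W x ^ 2 ≤ M * ε * |b - a| := hsplit ▸
          (le_abs_self _).trans (intervalIntegral.norm_integral_le_of_norm_le_const hbound)
      _ = ε * (M * (b - a)) := by rw [abs_of_pos (sub_pos.2 hab)]; ring
  have hsq : ∫ x in a..b, W x ^ 2 ≤ 0 := by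
    by_contra! hpos
    have hD : 0 < M * (b - a) + 1 := by nlinarith
    have := hsq_le _ (div_pos hpos hD)
    rw [div_mul_eq_mul_div, le_div_iff₀ hD] at this
    linarith
  intro x hx
  by_contra hne
  exact hsq.not_gt <| intervalIntegral.integral_pos hab (hW.pow 2) (fun _ _ => sq_nonneg _)
    ⟨x, hx, sq_pos_of_ne_zero hne⟩

theorem integral_mul_cos_mul_cos_pow (hF : ContinuousOn F (Icc 0 1))
    (h : ∀ k : ℤ, ∫ l in (0 : ℝ)..1, F l * Real.cos ((k + 1 / 2) * Real.pi * l) = 0)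
    (j : ℕ) (k : ℤ) :
    ∫ l in (0 : ℝ)..1,
      F l * Real.cos ((k + 1 / 2) * Real.pi * l) * Real.cos (Real.pi * l) ^ j = 0 := by
  have hint (j : ℕ) (k : ℤ) : IntervalIntegrable (fun l =>
      F l * Real.cos ((k + 1 / 2) * Real.pi * l) * Real.cos (Real.pi * l) ^ j) volume 0 1 :=
    ContinuousOn.intervalIntegrable_of_Icc zero_le_one (by fun_prop)
  induction j generalizing k with
  | zero => simpa using h k
  | succ j ih =>
    have product_to_sum (l : ℝ) :
        F l * Real.cos ((k + 1 / 2) * Real.pi * l) * Real.cos (Real.pi * l) ^ (j + 1) =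
        1 / 2 * (F l * Real.cos (((k + 1 : ℤ) + 1 / 2) * Real.pi * l) *
            Real.cos (Real.pi * l) ^ j +
          F l * Real.cos (((k - 1 : ℤ) + 1 / 2) * Real.pi * l) *
            Real.cos (Real.pi * l) ^ j) := by
      rw [show ((k + 1 : ℤ) + 1 / 2) * Real.pi * l =
          (k + 1 / 2) * Real.pi * l + Real.pi * l by push_cast; ring,
        show ((k - 1 : ℤ) + 1 / 2) * Real.pi * l =
          (k + 1 / 2) * Real.pi * l - Real.pi * l by push_cast; ring,
        Real.cos_add, Real.cos_sub]
      ring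
    simp_rw [product_to_sum]
    rw [intervalIntegral.integral_const_mul,
      intervalIntegral.integral_add (hint j (k + 1)) (hint j (k - 1)), ih, ih, add_zero, mul_zero]

theorem eqOn_zero_of_integral_mul_cos_eq_zero (hF : ContinuousOn F (Icc 0 1))
    (h : ∀ k : ℤ, ∫ l in (0 : ℝ)..1, F l * Real.cos ((k + 1 / 2) * Real.pi * l) = 0) :
    EqOn F 0 (Icc 0 1) := by
  have hpi := Real.pi_pos
  have hinj : InjOn (fun l => Real.cos (Real.pi * l)) (Icc 0 1) :=
    Real.injOn_cos.comp (mul_right_injective₀ hpi.ne').injOn fun l hl =>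
      ⟨by nlinarith [hl.1], by nlinarith [hl.2]⟩
  have hmul := eqOn_zero_of_integral_mul_pow_eq_zero zero_lt_one
    (W := fun l => F l * Real.cos (((0 : ℤ) + 1 / 2) * Real.pi * l)) (hF.mul (by fun_prop))
    (by fun_prop) hinj fun j => integral_mul_cos_mul_cos_pow hF h j 0
  have hIco : EqOn F 0 (Ico 0 1) := fun l hl =>
    (mul_eq_zero.1 (hmul ⟨hl.1, hl.2.le⟩)).resolve_right
      (Real.cos_pos_of_mem_Ioo ⟨by norm_num; nlinarith [hl.1], by norm_num; nlinarith [hl.2]⟩).ne'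
  exact hIco.of_subset_closure hF continuousOn_const Ico_subset_Icc_self
    (by rw [closure_Ico zero_ne_one])

end

section
open MeasureTheory Filter Topology

variable {γ μ : ℝ} {J J' S S' : Set ℝ} {u u' g g' g'' : ℝ → ℝ} {w w' : ℝ → ℝ → ℝ}

theorem continuousOn_intervalIntegral {s : Set ℝ} (hs : IsCompact s) {a b : ℝ} (hab : a ≤ b)
    {F : ℝ → ℝ → ℝ} (hF : ContinuousOn (fun p : ℝ × ℝ => F p.1 p.2) (s ×ˢ Icc a b)) :
    ContinuousOn (fun x => ∫ l in a..b, F x l) s := by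
  obtain ⟨M, hM⟩ := (hs.prod isCompact_Icc).exists_bound_of_continuousOn hF
  have hsub : uIoc a b ⊆ Icc a b := uIoc_of_le hab ▸ Ioc_subset_Icc_self
  refine fun x hx => intervalIntegral.continuousWithinAt_of_dominated_interval
    (bound := fun _ => M) ?_ ?_ intervalIntegrable_const ?_
  · filter_upwards [self_mem_nhdsWithin] with y hy
    exact ((hF.uncurry_left y hy).mono hsub).aestronglyMeasurable measurableSet_uIoc
  · filter_upwards [self_mem_nhdsWithin] with y hy
    exact ae_of_all _ fun l hl => hM (y, l) ⟨hy, hsub hl⟩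
  · exact ae_of_all _ fun l hl => hF.uncurry_right l (hsub hl) x hx

/-- The cosine coefficient of frequency `μ` of a function on `[0,1]`. -/
noncomputable def cosMode (μ : ℝ) (g : ℝ → ℝ) : ℝ :=
  ∫ l in (0 : ℝ)..1, g l * Real.cos (μ * l)

theorem sq_integral_le_integral_sq (hg : ContinuousOn g (Icc 0 1)) :
    (∫ l in (0 : ℝ)..1, g l) ^ 2 ≤ ∫ l in (0 : ℝ)..1, g l ^ 2 := by
  set m := ∫ l in (0 : ℝ)..1, g l
  have hint (F : ℝ → ℝ) (hF : ContinuousOn F (Icc 0 1)) : IntervalIntegrable F volume 0 1 :=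
    hF.intervalIntegrable_of_Icc zero_le_one
  have hvar : ∫ l in (0 : ℝ)..1, (g l - m) ^ 2 = (∫ l in (0 : ℝ)..1, g l ^ 2) - m ^ 2 := by
    simp only [sub_sq, mul_right_comm 2 _ m]
    rw [intervalIntegral.integral_add (hint _ (by fun_prop)) (hint _ (by fun_prop)),
      intervalIntegral.integral_sub (hint _ (by fun_prop)) (hint _ (by fun_prop)),
      intervalIntegral.integral_const_mul, intervalIntegral.integral_const]
    simp only [sub_zero, one_smul]
    ring
  have := intervalIntegral.integral_nonneg (μ := volume) (zero_le_one' ℝ)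
    fun l _ => sq_nonneg (g l - m)
  linarith

theorem abs_cosMode_le (hg : ContinuousOn g (Icc 0 1)) :
    |cosMode μ g| ≤ Real.sqrt (∫ l in (0 : ℝ)..1, g l ^ 2) := by
  have hgcos : ContinuousOn (fun l => g l * Real.cos (μ * l)) (Icc 0 1) := by fun_prop
  refine Real.abs_le_sqrt ((sq_integral_le_integral_sq hgcos).trans ?_)
  refine intervalIntegral.integral_mono_on zero_le_one
    ((hgcos.pow 2).intervalIntegrable_of_Icc zero_le_one)
    ((hg.pow 2).intervalIntegrable_of_Icc zero_le_one) fun l _ => ?_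
  rw [mul_pow]
  exact mul_le_of_le_one_right (sq_nonneg _) (Real.cos_sq_le_one _)

theorem cosMode_deriv_deriv (hg : ∀ l ∈ Icc (0 : ℝ) 1, HasDerivWithinAt g (g' l) (Icc 0 1) l)
    (hg' : ∀ l ∈ Icc (0 : ℝ) 1, HasDerivWithinAt g' (g'' l) (Icc 0 1) l)
    (hg'' : ContinuousOn g'' (Icc 0 1)) (h0 : g' 0 = 0) (hμ : Real.cos μ = 0) :
    cosMode μ g'' = μ * (g 1 * Real.sin μ) - μ ^ 2 * cosMode μ g := by
  have hgc : ContinuousOn g (Icc 0 1) := fun l hl => (hg l hl).continuousWithinAt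
  have hgc' : ContinuousOn g' (Icc 0 1) := fun l hl => (hg' l hl).continuousWithinAt
  have hderiv : ∀ l ∈ Ioo (0 : ℝ) 1,
      HasDerivAt (fun l => g' l * Real.cos (μ * l) + μ * (g l * Real.sin (μ * l)))
        (g'' l * Real.cos (μ * l) + μ ^ 2 * (g l * Real.cos (μ * l))) l := fun l hl => by
    have hmem := Ioo_subset_Icc_self hl
    have hmul : HasDerivAt (fun l : ℝ => μ * l) μ l := by
      simpa using (hasDerivAt_id l).const_mul μ
    have h1 := ((hg l hmem).hasDerivAt (Icc_mem_nhds hl.1 hl.2)).mul hmul.sin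
    have h2 := ((hg' l hmem).hasDerivAt (Icc_mem_nhds hl.1 hl.2)).mul hmul.cos
    exact (h2.add (h1.const_mul μ)).congr_deriv (by ring)
  have hint (F : ℝ → ℝ) (hF : ContinuousOn F (Icc 0 1)) : IntervalIntegrable F volume 0 1 :=
    hF.intervalIntegrable_of_Icc zero_le_one
  have hftc := intervalIntegral.integral_eq_sub_of_hasDerivAt_of_le zero_le_one (by fun_prop)
    hderiv (hint _ (by fun_prop))
  rw [intervalIntegral.integral_add (hint _ (by fun_prop)) (hint _ (by fun_prop)),
    intervalIntegral.integral_const_mul] at hftc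
  simp only [mul_one, mul_zero, Real.sin_zero, hμ, h0, zero_mul, add_zero, zero_add,
    sub_zero] at hftc
  exact eq_sub_of_add_eq hftc

theorem hasDerivAt_cosMode {a b t : ℝ} {wt : ℝ → ℝ → ℝ}
    (hw : ContinuousOn (fun p : ℝ × ℝ => w p.1 p.2) (Icc a b ×ˢ Icc 0 1))
    (hwt : ContinuousOn (fun p : ℝ × ℝ => wt p.1 p.2) (Icc a b ×ˢ Icc 0 1))
    (hder : ∀ t ∈ Icc a b, ∀ l ∈ Icc (0 : ℝ) 1,
      HasDerivWithinAt (fun s => w s l) (wt t l) (Icc a b) t) (ht : t ∈ Ioo a b) :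
    HasDerivAt (fun s => cosMode μ (w s)) (cosMode μ (wt t)) t := by
  have hsub : uIoc (0 : ℝ) 1 ⊆ Icc 0 1 := uIoc_of_le (zero_le_one' ℝ) ▸ Ioc_subset_Icc_self
  have hslice {F : ℝ → ℝ → ℝ} (hF : ContinuousOn (fun p : ℝ × ℝ => F p.1 p.2)
      (Icc a b ×ˢ Icc 0 1)) {s : ℝ} (hs : s ∈ Ioo a b) :
      ContinuousOn (fun l => F s l * Real.cos (μ * l)) (Icc 0 1) :=
    (hF.uncurry_left s (Ioo_subset_Icc_self hs)).mul (by fun_prop)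
  have hmeas {F : ℝ → ℝ} (hF : ContinuousOn F (Icc 0 1)) :
      AEStronglyMeasurable F (volume.restrict (uIoc 0 1)) :=
    (hF.mono hsub).aestronglyMeasurable measurableSet_uIoc
  have hwtcos : ContinuousOn (fun p : ℝ × ℝ => wt p.1 p.2 * Real.cos (μ * p.2))
      (Icc a b ×ˢ Icc 0 1) := by fun_prop
  obtain ⟨M, hM⟩ := (isCompact_Icc.prod isCompact_Icc).exists_bound_of_continuousOn hwtcos
  refine (intervalIntegral.hasDerivAt_integral_of_dominated_loc_of_deriv_le
    (F' := fun s l => wt s l * Real.cos (μ * l)) (bound := fun _ => M)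
    (Ioo_mem_nhds ht.1 ht.2) ?_ ((hslice hw ht).intervalIntegrable_of_Icc zero_le_one)
    (hmeas (hslice hwt ht)) ?_ intervalIntegrable_const ?_).2
  · filter_upwards [Ioo_mem_nhds ht.1 ht.2] with s hs using hmeas (hslice hw hs)
  · exact ae_of_all _ fun l hl s hs => hM (s, l) ⟨Ioo_subset_Icc_self hs, hsub hl⟩
  · exact ae_of_all _ fun l hl s hs => ((hder s (Ioo_subset_Icc_self hs) l (hsub hl)).hasDerivAt
      (Icc_mem_nhds hs.1 hs.2)).mul_const _

namespace IsHeatSolution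

theorem continuousOn_slice (hw : IsHeatSolution γ J S u w) {t : ℝ} (ht : t ∈ J) :
    ContinuousOn (w t) (Icc 0 1) :=
  hw.continuousOn.uncurry_left t ht

theorem hasDerivAt_cosMode {a b : ℝ} (hw : IsHeatSolution γ (Icc a b) (Icc 0 1) u w)
    (hμ : Real.cos μ = 0) {t : ℝ} (ht : t ∈ Ioo a b) :
    HasDerivAt (fun s => cosMode μ (w s))
      (μ * Real.sin μ * u t - (μ ^ 2 + γ) * cosMode μ (w t)) t := by
  obtain ⟨wt, wl, wll, hwt, -, hwll, hder, hneu⟩ := hw.heat_neumann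
  have htJ := Ioo_subset_Icc_self ht
  have hwc := hw.continuousOn_slice htJ
  have hwllc : ContinuousOn (wll t) (Icc 0 1) := hwll.uncurry_left t htJ
  have hint (F : ℝ → ℝ) (hF : ContinuousOn F (Icc 0 1)) : IntervalIntegrable F volume 0 1 :=
    hF.intervalIntegrable_of_Icc zero_le_one
  have hpde : cosMode μ (wt t) = cosMode μ (wll t) - γ * cosMode μ (w t) := by
    rw [cosMode, cosMode, cosMode, ← intervalIntegral.integral_const_mul,
      ← intervalIntegral.integral_sub (hint _ (by fun_prop)) (hint _ (by fun_prop))]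
    refine intervalIntegral.integral_congr fun l hl => ?_
    simp only [(hder t htJ l (uIcc_of_le (zero_le_one' ℝ) ▸ hl)).2.2.2]
    ring
  refine (_root_.hasDerivAt_cosMode hw.continuousOn hwt (fun s hs l hl => (hder s hs l hl).1)
    ht).congr_deriv ?_
  rw [hpde, cosMode_deriv_deriv (fun l hl => (hder t htJ l hl).2.1)
    (fun l hl => (hder t htJ l hl).2.2.1) hwllc (hneu t htJ) hμ, hw.dirichlet t htJ]
  ring

theorem cosMode_duhamel_Icc {r t : ℝ} (hrt : r ≤ t)
    (hw : IsHeatSolution γ (Icc r t) (Icc 0 1) u w) (hμ : Real.cos μ = 0) :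
    Real.exp ((μ ^ 2 + γ) * t) * cosMode μ (w t) - Real.exp ((μ ^ 2 + γ) * r) * cosMode μ (w r) =
      ∫ s in r..t, Real.exp ((μ ^ 2 + γ) * s) * (μ * Real.sin μ * u s) := by
  have hu : ContinuousOn u (Icc r t) :=
    (hw.continuousOn.uncurry_right 1 (right_mem_Icc.2 zero_le_one)).congr fun s hs =>
      (hw.dirichlet s hs).symm
  have hmode : ContinuousOn (fun s => cosMode μ (w s)) (Icc r t) := by
    have := hw.continuousOn
    exact continuousOn_intervalIntegral isCompact_Icc zero_le_one (by fun_prop)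
  refine (intervalIntegral.integral_eq_sub_of_hasDerivAt_of_le hrt
    (f := fun s => Real.exp ((μ ^ 2 + γ) * s) * cosMode μ (w s)) (by fun_prop)
    (fun s hs => ?_) (ContinuousOn.intervalIntegrable_of_Icc hrt (by fun_prop))).symm
  have hexp : HasDerivAt (fun s => Real.exp ((μ ^ 2 + γ) * s))
      (Real.exp ((μ ^ 2 + γ) * s) * (μ ^ 2 + γ)) s := by
    simpa using ((hasDerivAt_id s).const_mul (μ ^ 2 + γ)).exp
  exact (hexp.mul (hw.hasDerivAt_cosMode hμ hs)).congr_deriv (by ring)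

theorem comp_parabolic (hw : IsHeatSolution γ J S u w) {a b : ℝ} (hb : b ∈ Icc (0 : ℝ) 1)
    (hJ : MapsTo (fun t => b ^ 2 * t + a) J' J) (hS : MapsTo (fun l => b * l) S' S)
    (hu : ∀ t ∈ J', w (b ^ 2 * t + a) b = u' t) :
    IsHeatSolution (b ^ 2 * γ) J' S' u' (fun t l => w (b ^ 2 * t + a) (b * l)) := by
  obtain ⟨wt, wl, wll, hwt, hwl, hwll, hder, hneu⟩ := hw.heat_neumann
  have hcomp {A B : Set ℝ} {F : ℝ → ℝ → ℝ} (hAB : MapsTo (fun l => b * l) A B)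
      (hF : ContinuousOn (fun p : ℝ × ℝ => F p.1 p.2) (J ×ˢ B)) :
      ContinuousOn (fun p : ℝ × ℝ => F (b ^ 2 * p.1 + a) (b * p.2)) (J' ×ˢ A) :=
    hF.comp (f := fun p : ℝ × ℝ => (b ^ 2 * p.1 + a, b * p.2)) (by fun_prop)
      fun p hp => ⟨hJ hp.1, hAB hp.2⟩
  have hIcc : MapsTo (fun l => b * l) (Icc (0 : ℝ) 1) (Icc 0 1) := fun l hl =>
    ⟨mul_nonneg hb.1 hl.1, mul_le_one₀ hb.2 hl.1 hl.2⟩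
  refine ⟨hcomp hIcc hw.continuousOn, ⟨fun t l => b ^ 2 * wt (b ^ 2 * t + a) (b * l),
    fun t l => b * wl (b ^ 2 * t + a) (b * l), fun t l => b ^ 2 * wll (b ^ 2 * t + a) (b * l),
    continuousOn_const.mul (hcomp hS hwt), continuousOn_const.mul (hcomp hS hwl),
    continuousOn_const.mul (hcomp hS hwll), fun t ht l hl => ?_,
    fun t ht => by simp only [mul_zero, hneu _ (hJ ht)]⟩, fun t ht => by rw [mul_one, hu t ht]⟩
  obtain ⟨h1, h2, h3, h4⟩ := hder _ (hJ ht) _ (hS hl)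
  have htime : HasDerivWithinAt (fun t => b ^ 2 * t + a) (b ^ 2) J' t := by
    simpa using (((hasDerivAt_id t).const_mul (b ^ 2)).add_const a).hasDerivWithinAt
  have hspace : HasDerivWithinAt (fun l => b * l) b S' l := by
    simpa using ((hasDerivAt_id l).const_mul b).hasDerivWithinAt
  refine ⟨(HasDerivWithinAt.comp (h₂ := fun s => w s (b * l)) t h1 htime hJ).congr_deriv
      (mul_comm _ _),
    (HasDerivWithinAt.comp (h₂ := w (b ^ 2 * t + a)) l h2 hspace hS).congr_deriv (mul_comm _ _),
    ((HasDerivWithinAt.comp (h₂ := wl (b ^ 2 * t + a)) l h3 hspace hS).const_mul b).congr_deriv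
      (by ring), ?_⟩
  simp only at h4 ⊢
  rw [h4]
  ring

theorem mono (hw : IsHeatSolution γ J S u w) (hJ : J' ⊆ J) : IsHeatSolution γ J' S u w := by
  simpa using hw.comp_parabolic (a := 0) (b := 1) ⟨zero_le_one, le_rfl⟩
    (fun t ht => by simpa using hJ ht) (by simp [MapsTo]) fun t ht => by
      simpa using hw.dirichlet t (hJ ht)

theorem comp_add_const (hw : IsHeatSolution γ univ S u w) (a : ℝ) :
    IsHeatSolution γ univ S (fun t => u (t + a)) (fun t l => w (t + a) l) := by
  simpa using hw.comp_parabolic (a := a) (b := 1) ⟨zero_le_one, le_rfl⟩ (mapsTo_univ _ _)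
    (by simp [MapsTo]) fun t _ => by simpa using hw.dirichlet (t + a) trivial

/- The dilations `w (b ^ 2 * t) (b * l)` with `b < 1` solve a heat equation up to `l = 1`, where the
derivatives of `w` itself need not exist; the formula passes to the limit `b → 1`. -/
theorem cosMode_duhamel_Iic (hw : IsHeatSolution γ (Iic 0) (Ico 0 1) u w) (hμ : Real.cos μ = 0)
    {r t : ℝ} (hrt : r ≤ t) (ht : t ≤ 0) :
    Real.exp ((μ ^ 2 + γ) * t) * cosMode μ (w t) - Real.exp ((μ ^ 2 + γ) * r) * cosMode μ (w r) =
      ∫ s in r..t, Real.exp ((μ ^ 2 + γ) * s) * (μ * Real.sin μ * u s) := by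
  set v : ℝ → ℝ → ℝ → ℝ := fun b s l => w (b ^ 2 * s) (b * l)
  set lhs : ℝ → ℝ → ℝ := fun s b => Real.exp ((μ ^ 2 + b ^ 2 * γ) * s) * cosMode μ (v b s)
  set rhs : ℝ → ℝ := fun b =>
    ∫ s in r..t, Real.exp ((μ ^ 2 + b ^ 2 * γ) * s) * (μ * Real.sin μ * v b s 1)
  have hIco : EqOn (fun b => lhs t b - lhs r b) rhs (Ico 0 1) := fun b hb => by
    have hv := hw.comp_parabolic (a := 0) (J' := Icc r t) (S' := Icc 0 1)
      (u' := fun s => v b s 1) ⟨hb.1, hb.2.le⟩ (fun s hs => by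
        simpa using mul_nonpos_of_nonneg_of_nonpos (sq_nonneg b) (hs.2.trans ht))
      (fun l hl => ⟨mul_nonneg hb.1 hl.1, (mul_le_of_le_one_right hb.1 hl.2).trans_lt hb.2⟩)
      (fun s _ => by simp [v])
    simp only [add_zero] at hv
    exact cosMode_duhamel_Icc hrt hv hμ
  have hlhs {s : ℝ} (hs : s ≤ 0) : ContinuousOn (lhs s) (Icc 0 1) := by
    have hv : ContinuousOn (fun p : ℝ × ℝ => v p.1 s p.2) (Icc 0 1 ×ˢ Icc 0 1) :=
      hw.continuousOn.comp (f := fun p : ℝ × ℝ => (p.1 ^ 2 * s, p.1 * p.2)) (by fun_prop)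
        fun p hp => ⟨mul_nonpos_of_nonneg_of_nonpos (sq_nonneg _) hs,
          mul_nonneg hp.1.1 hp.2.1, mul_le_one₀ hp.1.2 hp.2.1 hp.2.2⟩
    have hmode : ContinuousOn (fun b => cosMode μ (v b s)) (Icc 0 1) :=
      continuousOn_intervalIntegral isCompact_Icc zero_le_one (by fun_prop)
    fun_prop
  have hrhs : ContinuousOn rhs (Icc 0 1) := by
    have hv : ContinuousOn (fun p : ℝ × ℝ => v p.1 p.2 1) (Icc 0 1 ×ˢ Icc r t) :=
      hw.continuousOn.comp (f := fun p : ℝ × ℝ => (p.1 ^ 2 * p.2, p.1 * 1)) (by fun_prop)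
        fun p hp => ⟨mul_nonpos_of_nonneg_of_nonpos (sq_nonneg _) (hp.2.2.trans ht),
          by simpa using hp.1⟩
    exact continuousOn_intervalIntegral isCompact_Icc hrt (by fun_prop)
  have hone := hIco.of_subset_closure ((hlhs ht).sub (hlhs (hrt.trans ht))) hrhs
    Ico_subset_Icc_self (by rw [closure_Ico zero_ne_one]) ⟨zero_le_one, le_rfl⟩
  simp only [lhs, rhs, v, one_pow, one_mul] at hone
  rw [hone]
  refine intervalIntegral.integral_congr fun s hs => ?_
  rw [uIcc_of_le hrt] at hs
  simp only [hw.dirichlet s (hs.2.trans ht)]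

end IsHeatSolution

namespace IsSteadySolution

theorem cosMode_eq (hw : IsSteadySolution γ u w) (hw' : IsSteadySolution γ u w')
    (hμ : Real.cos μ = 0) {t : ℝ} (ht : t ≤ 0) : cosMode μ (w t) = cosMode μ (w' t) := by
  obtain ⟨C, -, hC⟩ := hw.growth
  obtain ⟨C', -, hC'⟩ := hw'.growth
  set D : ℝ → ℝ := fun r =>
    Real.exp ((μ ^ 2 + γ) * r) * (cosMode μ (w r) - cosMode μ (w' r))
  have hconst {r : ℝ} (hr : r ≤ t) : D t = D r := by
    linear_combination hw.isHeatSolution.cosMode_duhamel_Iic hμ hr ht -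
      hw'.isHeatSolution.cosMode_duhamel_Iic hμ hr ht
  have hbound {r : ℝ} (hr : r ≤ 0) : ‖D r‖ ≤ (C + C') * Real.exp (μ ^ 2 * r) := by
    have hmode := (abs_cosMode_le (μ := μ) (hw.isHeatSolution.continuousOn_slice hr)).trans
      (hC r hr).le
    have hmode' := (abs_cosMode_le (μ := μ) (hw'.isHeatSolution.continuousOn_slice hr)).trans
      (hC' r hr).le
    calc ‖D r‖ ≤ Real.exp ((μ ^ 2 + γ) * r) *
          (C * Real.exp (-γ * r) + C' * Real.exp (-γ * r)) := by
          rw [norm_mul, Real.norm_of_nonneg (Real.exp_pos _).le]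
          gcongr
          exact (norm_sub_le _ _).trans (add_le_add hmode hmode')
      _ = (C + C') * (Real.exp ((μ ^ 2 + γ) * r) * Real.exp (-γ * r)) := by ring
      _ = (C + C') * Real.exp (μ ^ 2 * r) := by rw [← Real.exp_add]; ring_nf
  have hμ0 : 0 < μ ^ 2 := by
    refine sq_pos_of_ne_zero fun h => ?_
    simp [h] at hμ
  have hlim : Tendsto (fun r => (C + C') * Real.exp (μ ^ 2 * r)) atBot (𝓝 0) := by
    simpa using (Real.tendsto_exp_atBot.comp (tendsto_id.const_mul_atBot hμ0)).const_mul (C + C')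
  have hD : D t = 0 := norm_le_zero_iff.1 <| ge_of_tendsto hlim <| by
    filter_upwards [eventually_le_atBot t] with r hr
    exact hconst hr ▸ hbound (hr.trans ht)
  exact sub_eq_zero.1 ((mul_eq_zero.1 hD).resolve_left (Real.exp_pos _).ne')

theorem eq (hw : IsSteadySolution γ u w) (hw' : IsSteadySolution γ u w') {t : ℝ} (ht : t ≤ 0)
    {l : ℝ} (hl : l ∈ Icc (0 : ℝ) 1) : w t l = w' t l := by
  have hc := hw.isHeatSolution.continuousOn_slice ht
  have hc' := hw'.isHeatSolution.continuousOn_slice ht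
  refine sub_eq_zero.1 (eqOn_zero_of_integral_mul_cos_eq_zero (hc.sub hc') (fun k => ?_) hl)
  have hcos : Real.cos ((k + 1 / 2) * Real.pi) = 0 := Real.cos_eq_zero_iff.2 ⟨k, by ring⟩
  simp only [Pi.sub_apply, sub_mul _ (w' t _)]
  rw [intervalIntegral.integral_sub
    (ContinuousOn.intervalIntegrable_of_Icc zero_le_one (by fun_prop))
    (ContinuousOn.intervalIntegrable_of_Icc zero_le_one (by fun_prop))]
  exact sub_eq_zero.2 (hw.cosMode_eq hw' hcos ht)

theorem steadySolution_eq (hw : IsSteadySolution γ u w) {t : ℝ} (ht : t ≤ 0) {l : ℝ}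
    (hl : l ∈ Icc (0 : ℝ) 1) : steadySolution γ u t l = w t l := by
  have hex : ∃ w, IsSteadySolution γ u w := ⟨w, hw⟩
  rw [steadySolution, dif_pos hex]
  exact hex.choose_spec.eq hw ht hl

end IsSteadySolution

end

section

variable {γ γ₀ : ℝ} {J S : Set ℝ} {u : ℝ → ℝ} {w w' : ℝ → ℝ → ℝ}

namespace IsHeatSolution

theorem exp_mul (hw : IsHeatSolution γ J S u w) (hS : S ⊆ Icc 0 1) (β : ℝ) :
    IsHeatSolution (γ + β) J S (fun t => Real.exp (-β * t) * u t)
      (fun t l => Real.exp (-β * t) * w t l) := by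
  obtain ⟨wt, wl, wll, hwt, hwl, hwll, hder, hneu⟩ := hw.heat_neumann
  have hwc := hw.continuousOn
  have hwS : ContinuousOn (fun p : ℝ × ℝ => w p.1 p.2) (J ×ˢ S) :=
    hwc.mono (prod_mono Subset.rfl hS)
  refine ⟨by fun_prop, ⟨fun t l => Real.exp (-β * t) * (wt t l - β * w t l),
    fun t l => Real.exp (-β * t) * wl t l, fun t l => Real.exp (-β * t) * wll t l,
    by fun_prop, by fun_prop, by fun_prop, fun t ht l hl => ?_,
    fun t ht => by simp only [hneu t ht, mul_zero]⟩, fun t ht => by simp only [hw.dirichlet t ht]⟩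
  obtain ⟨h1, h2, h3, h4⟩ := hder t ht l hl
  have hexp : HasDerivAt (fun s => Real.exp (-β * s)) (Real.exp (-β * t) * -β) t := by
    simpa using ((hasDerivAt_id t).const_mul (-β)).exp
  refine ⟨(hexp.hasDerivWithinAt.mul h1).congr_deriv (by ring), h2.const_mul _, h3.const_mul _, ?_⟩
  simp only [h4]
  ring

theorem congr (hw : IsHeatSolution γ J S u w) (hS : S ⊆ Icc 0 1)
    (h : ∀ t ∈ J, ∀ l ∈ Icc (0 : ℝ) 1, w' t l = w t l) : IsHeatSolution γ J S u w' := by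
  obtain ⟨wt, wl, wll, hwt, hwl, hwll, hder, hneu⟩ := hw.heat_neumann
  refine ⟨hw.continuousOn.congr fun p hp => h _ hp.1 _ hp.2, ⟨wt, wl, wll, hwt, hwl, hwll,
    fun t ht l hl => ?_, hneu⟩, fun t ht => ?_⟩
  · obtain ⟨h1, h2, h3, h4⟩ := hder t ht l hl
    exact ⟨h1.congr (fun s hs => h s hs l (hS hl)) (h t ht l (hS hl)),
      h2.congr (fun r hr => h t ht r (hS hr)) (h t ht l (hS hl)), h3,
      by rw [h4, h t ht l (hS hl)]⟩
  · rw [h t ht 1 ⟨zero_le_one, le_rfl⟩, hw.dirichlet t ht]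

theorem isSteadySolution_comp_add_const (hw : IsHeatSolution γ univ (Ico 0 1) u w) {a K : ℝ}
    (hK : ∀ t ≤ a, ∀ l ∈ Icc (0 : ℝ) 1, |w t l| ≤ K * Real.exp (-γ * t)) :
    IsSteadySolution γ (fun t => u (t + a)) (fun t l => w (t + a) l) := by
  have hK0 : 0 ≤ K := nonneg_of_mul_nonneg_left
    ((abs_nonneg _).trans (hK a le_rfl 0 ⟨le_rfl, zero_le_one⟩)) (Real.exp_pos _)
  refine ⟨(hw.comp_add_const a).mono (subset_univ _), K * Real.exp (-γ * a) + 1, by positivity,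
    fun t ht => ?_⟩
  have hsq : ∀ l ∈ uIoc (0 : ℝ) 1,
      ‖w (t + a) l ^ 2‖ ≤ (K * Real.exp (-γ * a) * Real.exp (-γ * t)) ^ 2 := fun l hl => by
    have hwK := hK (t + a) (by linarith) l
      (Ioc_subset_Icc_self (uIoc_of_le (zero_le_one' ℝ) ▸ hl))
    rw [norm_pow]
    refine pow_le_pow_left₀ (norm_nonneg _) (hwK.trans_eq ?_) 2
    rw [mul_assoc, ← Real.exp_add]
    ring_nf
  have hint := intervalIntegral.norm_integral_le_of_norm_le_const hsq
  rw [sub_zero, abs_one, mul_one] at hint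
  calc Real.sqrt (∫ l in (0 : ℝ)..1, w (t + a) l ^ 2)
      ≤ K * Real.exp (-γ * a) * Real.exp (-γ * t) :=
        Real.sqrt_le_iff.2 ⟨by positivity, (le_abs_self _).trans hint⟩
    _ < (K * Real.exp (-γ * a) + 1) * Real.exp (-γ * t) := by
        gcongr
        linarith

end IsHeatSolution

theorem hasExpDecay_exp_mul (hu : Continuous u) {C : ℝ}
    (hC : ∀ t ≤ 0, Real.exp (γ₀ * t) * |u t| ≤ C) :
    HasExpDecay (γ - γ₀) (fun t => Real.exp (γ * t) * u t) := by
  refine HasExpDecay.of_forall_le (K := C) (by fun_prop) fun t ht => ?_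
  calc |Real.exp (γ * t) * u t| = Real.exp (γ₀ * t) * |u t| * Real.exp ((γ - γ₀) * t) := by
        rw [abs_mul, abs_of_pos (Real.exp_pos _), mul_right_comm, ← Real.exp_add]
        ring_nf
    _ ≤ C * Real.exp ((γ - γ₀) * t) := by
        gcongr
        exact hC t ht

theorem exists_isHeatSolution_univ (hγ : γ₀ < γ) (hu : Continuous u)
    {C : ℝ} (hC : ∀ t ≤ 0, Real.exp (γ₀ * t) * |u t| ≤ C) :
    ∃ w : ℝ → ℝ → ℝ, IsHeatSolution γ univ (Ico 0 1) u w ∧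
      (ContDiff ℝ 1 u → IsHeatSolution γ univ (Icc 0 1) u w) ∧
      ∀ a, IsSteadySolution γ (fun t => u (t + a)) (fun t l => w (t + a) l) := by
  obtain ⟨v, hv, hv1, hvb⟩ :=
    exists_isHeatSolution_zero_univ (sub_pos.2 hγ) (hasExpDecay_exp_mul hu hC)
  have hcancel : (fun t => Real.exp (-γ * t) * (Real.exp (γ * t) * u t)) = u := by
    ext t
    rw [← mul_assoc, ← Real.exp_add]
    simp
  have hw {S : Set ℝ} (hS : S ⊆ Icc 0 1)
      (h : IsHeatSolution 0 univ S (fun t => Real.exp (γ * t) * u t) v) :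
      IsHeatSolution γ univ S u (fun t l => Real.exp (-γ * t) * v t l) := by
    simpa only [zero_add, hcancel] using h.exp_mul hS γ
  refine ⟨_, hw Ico_subset_Icc_self hv, fun hu1 => hw Subset.rfl (hv1 (by fun_prop)), fun a => ?_⟩
  obtain ⟨K, hK⟩ := hvb a
  refine (hw Ico_subset_Icc_self hv).isSteadySolution_comp_add_const (K := K) fun t ht l _ => ?_
  rw [abs_mul, abs_of_pos (Real.exp_pos _), mul_comm]
  exact mul_le_mul_of_nonneg_right (hK t ht l) (Real.exp_pos _).le

end

section

variable {n : ℕ} {f : EuclideanSpace ℝ (Fin n) → EuclideanSpace ℝ (Fin n)}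
  {x : EuclideanSpace ℝ (Fin n)} {c c' : ℝ → EuclideanSpace ℝ (Fin n)}

namespace IsTrajectory

theorem continuous (hc : IsTrajectory f x c) : Continuous c :=
  continuous_iff_continuousAt.2 fun t => (hc.2 t).continuousAt

theorem comp_add_const (hc : IsTrajectory f x c) (a : ℝ) :
    IsTrajectory f (c a) (fun t => c (t + a)) :=
  ⟨congrArg c (zero_add a), fun t => (hc.2 (t + a)).comp_add_const t a⟩

theorem eq (hf : LocallyLipschitz f) (hc : IsTrajectory f x c) (hc' : IsTrajectory f x c') :
    c = c' := by
  ext1 t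
  obtain ⟨R, hR⟩ := exists_gt |t|
  set A := c '' Icc (-R) R ∪ c' '' Icc (-R) R
  have hA : IsCompact A :=
    (isCompact_Icc.image hc.continuous).union (isCompact_Icc.image hc'.continuous)
  obtain ⟨K, hK⟩ := (hf.locallyLipschitzOn (s := A)).exists_lipschitzOnWith_of_compact hA
  exact ODE_solution_unique_of_mem_Ioo (v := fun _ => f) (s := fun _ => A) (K := K) (t₀ := 0)
    (a := -R) (b := R) (fun _ _ => hK) (abs_lt.1 (abs_zero.trans_lt ((abs_nonneg t).trans_lt hR)))
    (fun s hs => ⟨hc.2 s, Or.inl ⟨s, Ioo_subset_Icc_self hs, rfl⟩⟩)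
    (fun s hs => ⟨hc'.2 s, Or.inr ⟨s, Ioo_subset_Icc_self hs, rfl⟩⟩) (hc.1.trans hc'.1.symm)
    (abs_lt.1 hR)

theorem flow_eq (hf : LocallyLipschitz f) (hc : IsTrajectory f x c) (t : ℝ) :
    flow f t x = c t := by
  have hex : ∃ c, IsTrajectory f x c := ⟨c, hc⟩
  rw [flow, dif_pos hex, hex.choose_spec.eq hf hc]

theorem flow_flow (hf : LocallyLipschitz f) (hc : IsTrajectory f x c) (t a : ℝ) :
    flow f t (flow f a x) = flow f (t + a) x := by
  rw [hc.flow_eq hf, hc.flow_eq hf, (hc.comp_add_const a).flow_eq hf]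

end IsTrajectory

end

theorem mainTheorem5_general {n : ℕ} {f : EuclideanSpace ℝ (Fin n) → EuclideanSpace ℝ (Fin n)}
    (hf : LocallyLipschitz f) {h : EuclideanSpace ℝ (Fin n) → ℝ} (hh : Continuous h)
    {x : EuclideanSpace ℝ (Fin n)}
    (hglobal : ∃ c : ℝ → EuclideanSpace ℝ (Fin n), IsTrajectory f x c)
    {γ₀ γ C : ℝ} (hbound : ∀ t ≤ 0, Real.exp (γ₀ * t) * |h (flow f t x)| ≤ C) (hγ : γ₀ < γ) :
    (∀ a, ∃ w : ℝ → ℝ → ℝ, IsSteadySolution γ (boundaryInput f h (flow f a x)) w ∧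
      (∀ w' : ℝ → ℝ → ℝ, IsSteadySolution γ (boundaryInput f h (flow f a x)) w' →
        ∀ t ∈ Iic (0 : ℝ), ∀ l ∈ Icc (0 : ℝ) 1, w' t l = w t l) ∧
      ∀ l ∈ Icc (0 : ℝ) 1, kklMap γ f h (flow f a x) l = w 0 l) ∧
    IsHeatSolution γ univ (Ico 0 1) (fun t => -h (flow f t x))
      (fun t l => kklMap γ f h (flow f t x) l) ∧
    (ContDiff ℝ 1 (fun t : ℝ => h (flow f t x)) →
      IsHeatSolution γ univ (Icc 0 1) (fun t => -h (flow f t x))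
        (fun t l => kklMap γ f h (flow f t x) l)) := by
  obtain ⟨c, hc⟩ := hglobal
  have hcont : Continuous (fun t => -h (flow f t x)) := by
    simp_rw [hc.flow_eq hf]
    exact (hh.comp hc.continuous).neg
  obtain ⟨w, hw, hw1, hsteady⟩ :=
    exists_isHeatSolution_univ hγ hcont (C := C) (by simpa only [abs_neg] using hbound)
  have hinput (a : ℝ) : boundaryInput f h (flow f a x) = fun t => -h (flow f (t + a) x) :=
    funext fun t => by rw [boundaryInput, hc.flow_flow hf]
  have hkkl (a : ℝ) {l : ℝ} (hl : l ∈ Icc (0 : ℝ) 1) : kklMap γ f h (flow f a x) l = w a l := by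
    rw [kklMap, hinput, (hsteady a).steadySolution_eq le_rfl hl, zero_add]
  refine ⟨fun a => ⟨fun t l => w (t + a) l, hinput a ▸ hsteady a, fun w' hw' t ht l hl => ?_,
      fun l hl => by simp only [hkkl a hl, zero_add]⟩,
    hw.congr Ico_subset_Icc_self fun t _ l hl => hkkl t hl,
    fun h1 => (hw1 h1.neg).congr Subset.rfl fun t _ l hl => hkkl t hl⟩
  exact (hinput a ▸ hw').eq (hsteady a) ht hl

theorem mainTheorem5 (n : ℕ)
    (f : EuclideanSpace ℝ (Fin n) → EuclideanSpace ℝ (Fin n)) (hf : LocallyLipschitz f)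
    (h : EuclideanSpace ℝ (Fin n) → ℝ) (hh : Continuous h)
    (X₀ : Set (EuclideanSpace ℝ (Fin n))) (hX₀ : IsOpen X₀)
    (hglobal : ∀ x ∈ X₀, ∃ c : ℝ → EuclideanSpace ℝ (Fin n), IsTrajectory f x c)
    (γ₀ : ℝ) (hγ₀ : 0 < γ₀)
    (hbound : ∀ x ∈ X₀, ∃ C : ℝ, 0 < C ∧
      ∀ t : ℝ, t ≤ 0 → Real.exp (γ₀ * t) * |h (flow f t x)| ≤ C)
    (γ : ℝ) (hγ : γ₀ < γ) :
    -- `T₀` is well defined on `𝒳`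
    (∀ x ∈ trajectorySet f X₀, ∃ w : ℝ → ℝ → ℝ,
      IsSteadySolution γ (boundaryInput f h x) w ∧
      (∀ w' : ℝ → ℝ → ℝ, IsSteadySolution γ (boundaryInput f h x) w' →
        ∀ t ∈ Set.Iic (0 : ℝ), ∀ l ∈ Set.Icc (0 : ℝ) 1, w' t l = w t l) ∧
      ∀ l ∈ Set.Icc (0 : ℝ) 1, kklMap γ f h x l = w 0 l) ∧
    -- `T₀` solves the heat equation along the flow
    (∀ x ∈ X₀,
      IsHeatSolution γ (Set.Ici 0) (Set.Ico 0 1) (fun t => -h (flow f t x))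
        (fun t l => kklMap γ f h (flow f t x) l)) ∧
    -- up to the boundary point `1` when the boundary datum is continuously differentiable
    (∀ x ∈ X₀, ContDiff ℝ 1 (fun t : ℝ => h (flow f t x)) →
      IsHeatSolution γ (Set.Ici 0) (Set.Icc 0 1) (fun t => -h (flow f t x))
        (fun t l => kklMap γ f h (flow f t x) l)) := by
  have key (x) (hx : x ∈ X₀) :=
    mainTheorem5_general hf hh (hglobal x hx) (hbound x hx).choose_spec.2 hγ
  refine ⟨?_, fun x hx => (key x hx).2.1.mono (subset_univ _),
    fun x hx h1 => ((key x hx).2.2 h1).mono (subset_univ _)⟩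
  rintro _ ⟨x, hx, a, -, rfl⟩
  exact (key x hx).1 a
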